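/- Let $m\ge 3$ be an integer. For $n\ge1$ let $\mathbb S_n=\mathbb C^{2^{\lfloor n/2\rfloor}}$ with its standard Hermitian norm, let Clifford multiplication be given by any skew-Hermitian linear maps $\alpha_1,\dots,\alpha_n$ of $\mathbb S_n$ with $\alpha_j\alpha_k+\alpha_k\alpha_j=-2\delta_{jk}$, write $x\cdot s=\sum_k x_k\alpha_k s$, and let $D\psi=\sum_k\alpha_k\,\partial_k\psi$ be the Euclidean Dirac operator on spinors $\psi$ with values in $\mathbb S_n$. Consider, with $n=m-1$, $$D\psi=f(x)^{\frac1{m-1}}|\psi|^{\frac2{m-1}}\psi\quad\text{on }\mathbb R^{m-1}\setminus\{0\},\qquad f(x)=\frac{2}{1+|x|^2}.\tag{1}$$ For every $\mu>0$ there is a unique solution $(u_\mu,v_\mu)$, defined on all of $\mathbb R$, of $$u'+\tfrac{m-2}2u=\cosh(t)^{-\frac1{m-1}}(u^2+v^2)^{\frac1{m-1}}v,\qquad -v'+\tfrac{m-2}2v=\cosh(t)^{-\frac1{m-1}}(u^2+v^2)^{\frac1{m-1}}u,$$ with $u(0)=v(0)=\mu$. Put $$H_\mu(t)=-\tfrac{m-2}2u_\mu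 v_\mu+\tfrac{m-1}{2m}\cosh(t)^{-\frac1{m-1}}(u_\mu^2+v_\mu^2)^{\frac m{m-1}},$$ and for $k=0,1,2,\dots$ let $A_k$ be the set of all $\mu>0$ such that $v_\mu$ changes sign exactly $k$ times on $(0,+\infty)$ and $\lim_{|t|\to\infty}H_\mu(t)$ exists in $[-\infty,0)$. The set $\bigcup_{k\ge0}A_k$ is a nonempty open subset of $(0,\infty)$. Let $\gamma_0\in\mathbb S_{m-1}$ with $|\gamma_0|=1$, and for $\mu\in\bigcup_kA_k$ and $x\ne0$ let $$\psi_\mu(x)=f_1(|x|)\gamma_0+\frac{f_2(|x|)}{|x|}\,x\cdot\gamma_0,\qquad f_1(e^{-t})=-u_\mu(t)e^{\frac{m-2}2t},\quad f_2(e^{-t})=v_\mu(t)e^{\frac{m-2}2t}.$$ Then $(\psi_\mu)_{\mu\in\bigcup_kA_k}$ is a one-parameter family of singular solutions of (1): each $\psi_\mu$ is smooth on $\mathbb R^{m-1}\setminus\{0\}$, solves (1), and satisfies $|\psi_\mu(x)|\to+\infty$ as $x\to0$; and $\psi_\mu\ne\psi_{\mu'}$ whenever $\mu\neq\mu'$.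 Moreover, for each $\mu\in\bigcup_kA_k$, $$|x|^{-\frac{m-2}2}<|\psi_\mu(x)|\lesssim|x|^{-\frac{m-1}2}\quad\text{as }|x|\to0,\qquad |x|^{-\frac{m-2}2}<|\psi_\mu(x)|\lesssim|x|^{-\frac{m-3}2}\quad\text{as }|x|\to+\infty,$$ where the strict inequalities hold for all $x$ close enough to $0$, respectively with $|x|$ large enough, and the implied constants may depend on $\mu$ (and $m$). -/

import Mathlib

open Filter Topology Asymptotics
open scoped ContDiff

noncomputable section

namespace SpinYamabe

/-! ### Spinors and the Dirac operator on Euclidean space -/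

/-- The spin module of dimension `2 ^ ⌊n / 2⌋` over `ℂ`, with its standard Hermitian norm. -/
abbrev Spinor (n : ℕ) : Type := EuclideanSpace ℂ (Fin (2 ^ (n / 2)))

/-- A spin representation of `ℝⁿ`: Clifford multiplication by the standard basis vectors is given by
skew-Hermitian endomorphisms `α k` of the spin module with `α j α k + α k α j = -2 δ_{jk}`.
(The dimension of the spin module makes every such representation irreducible.) -/
structure SpinRep (n : ℕ) where
  α : Fin n → (Spinor n →ₗ[ℂ] Spinor n)
  clifford : ∀ j k s, α j (α k s) + α k (α j s) = (if j = k then (-2 : ℂ) else 0) • s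
  skew : ∀ k s s', inner ℂ (α k s) s' = -inner ℂ s (α k s')

/-- Clifford multiplication `x · s = ∑ₖ xₖ αₖ s`. -/
def SpinRep.mul {n : ℕ} (S : SpinRep n) (x : EuclideanSpace ℝ (Fin n)) (s : Spinor n) : Spinor n :=
  ∑ k, x k • S.α k s

/-- The Euclidean Dirac operator `D ψ = ∑ₖ αₖ ∂ₖ ψ`. -/
def SpinRep.dirac {n : ℕ} (S : SpinRep n) (ψ : EuclideanSpace ℝ (Fin n) → Spinor n)
    (x : EuclideanSpace ℝ (Fin n)) : Spinor n :=
  ∑ k, S.α k (fderiv ℝ ψ x (EuclideanSpace.single k 1))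

/-- The weight `f(x) = 2 / (1 + |x|²)`. -/
def weight {n : ℕ} (x : EuclideanSpace ℝ (Fin n)) : ℝ := 2 / (1 + ‖x‖ ^ 2)

/-- `ψ` is a smooth solution of `D ψ = f^{1/(m-1)} |ψ|^{2/(m-1)} ψ` on `ℝ^{m-1} ∖ {0}`. -/
def IsSolution (m : ℕ) (S : SpinRep (m - 1))
    (ψ : EuclideanSpace ℝ (Fin (m - 1)) → Spinor (m - 1)) : Prop :=
  ContDiffOn ℝ ∞ ψ {0}ᶜ ∧
    ∀ x, x ≠ 0 → S.dirac ψ x =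
      (weight x ^ (1 / ((m : ℝ) - 1)) * ‖ψ x‖ ^ (2 / ((m : ℝ) - 1))) • ψ x

/-- The origin is a genuine singularity: `|ψ(x)| → +∞` as `x → 0`. -/
def IsSingular {n : ℕ} (ψ : EuclideanSpace ℝ (Fin n) → Spinor n) : Prop :=
  Tendsto (fun x => ‖ψ x‖) (𝓝[≠] 0) atTop

/-- The ansatz `ψ(x) = f₁(|x|) γ₀ + (f₂(|x|) / |x|) x · γ₀`. -/
def ansatz {n : ℕ} (S : SpinRep n) (γ₀ : Spinor n) (f₁ f₂ : ℝ → ℝ)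
    (x : EuclideanSpace ℝ (Fin n)) : Spinor n :=
  f₁ ‖x‖ • γ₀ + (f₂ ‖x‖ / ‖x‖) • S.mul x γ₀

/-- The spinor that belongs to `(u, v)`: the ansatz with
`f₁(r) = -u(t) e^{(m-2)t/2}`, `f₂(r) = v(t) e^{(m-2)t/2}`, where `r = e^{-t}`. -/
def spinorOf (m : ℕ) (S : SpinRep (m - 1)) (γ₀ : Spinor (m - 1)) (u v : ℝ → ℝ) :
    EuclideanSpace ℝ (Fin (m - 1)) → Spinor (m - 1) :=
  ansatz S γ₀
    (fun r => -u (-Real.log r) * Real.exp (((m : ℝ) - 2) / 2 * -Real.log r))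
    (fun r => v (-Real.log r) * Real.exp (((m : ℝ) - 2) / 2 * -Real.log r))

/-! ### The Hamiltonian system and the parameter sets -/

/-- `(u, v)` is a solution on all of `ℝ` of
`u' + (m-2)/2 u = cosh(t)^{-1/(m-1)} (u² + v²)^{1/(m-1)} v`,
`-v' + (m-2)/2 v = cosh(t)^{-1/(m-1)} (u² + v²)^{1/(m-1)} u`,
with `u(0) = v(0) = μ`. -/
structure IsShot (m : ℕ) (μ : ℝ) (u v : ℝ → ℝ) : Prop where
  u_zero : u 0 = μ
  v_zero : v 0 = μ
  deriv_u : ∀ t, HasDerivAt u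
    (Real.cosh t ^ (-(1 / ((m : ℝ) - 1))) * (u t ^ 2 + v t ^ 2) ^ (1 / ((m : ℝ) - 1)) * v t
      - ((m : ℝ) - 2) / 2 * u t) t
  deriv_v : ∀ t, HasDerivAt v
    (((m : ℝ) - 2) / 2 * v t
      - Real.cosh t ^ (-(1 / ((m : ℝ) - 1))) * (u t ^ 2 + v t ^ 2) ^ (1 / ((m : ℝ) - 1)) * u t) t

/-- The energy `H(t) = -(m-2)/2 u v + (m-1)/(2m) cosh(t)^{-1/(m-1)} (u² + v²)^{m/(m-1)}`. -/
def energy (m : ℕ) (u v : ℝ → ℝ) (t : ℝ) : ℝ :=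
  -(((m : ℝ) - 2) / 2) * (u t * v t)
    + ((m : ℝ) - 1) / (2 * m) * Real.cosh t ^ (-(1 / ((m : ℝ) - 1)))
      * (u t ^ 2 + v t ^ 2) ^ ((m : ℝ) / ((m : ℝ) - 1))

/-- `g` takes values of alternating strict signs at some `t₀ < t₁ < ⋯ < tₖ` in `s`. -/
def Alternates (g : ℝ → ℝ) (s : Set ℝ) (k : ℕ) : Prop :=
  ∃ t : Fin (k + 1) → ℝ, StrictMono t ∧ (∀ i, t i ∈ s) ∧
    ∀ i : Fin k, g (t i.castSucc) * g (t i.succ) < 0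

/-- `g` changes sign exactly `k` times on `s`. -/
def ChangesSign (g : ℝ → ℝ) (s : Set ℝ) (k : ℕ) : Prop :=
  Alternates g s k ∧ ¬Alternates g s (k + 1)

/-- The set `A_k` of those `μ > 0` for which `v_μ` changes sign `k` times on `(0, ∞)` and
`lim_{|t| → ∞} H_μ(t)` is negative, the value `-∞` being allowed. -/
def A (m k : ℕ) : Set ℝ :=
  {μ | 0 < μ ∧ ∃ u v : ℝ → ℝ, IsShot m μ u v ∧ ChangesSign v (Set.Ioi 0) k ∧
    ∃ L : EReal, L < 0 ∧ Tendsto (fun t => (energy m u v t : EReal)) (cocompact ℝ) (𝓝 L)}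

/-! ### Spin representations exist in every dimension -/

/-- `2p + 1` anticommuting skew-Hermitian matrices of size `2 ^ p` with square `-1`. -/
theorem exists_gamma (p : ℕ) :
    ∃ a : Fin (2 * p + 1) → Matrix (Fin (2 ^ p)) (Fin (2 ^ p)) ℂ,
      (∀ j k, a j * a k + a k * a j = (if j = k then (-2 : ℂ) else 0) • 1) ∧
        ∀ k, (a k).conjTranspose = -a k := by
  induction p with
  | zero =>
    refine ⟨fun _ => Complex.I • 1, fun j k => ?_, fun k => ?_⟩
    · have : j = k := Subsingleton.elim (α := Fin 1) j k
      simp only [this, if_true, smul_mul_smul_comm, Complex.I_mul_I, mul_one, ← add_smul]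
      norm_num
    · simp [Matrix.conjTranspose_smul]
  | succ p ih =>
    obtain ⟨a, ha, ha'⟩ := ih
    let e : Fin (2 ^ p) ⊕ Fin (2 ^ p) ≃ Fin (2 ^ (p + 1)) :=
      finSumFinEquiv.trans (finCongr (by rw [pow_succ]; ring))
    let b : Fin (2 * p + 1) → Matrix (Fin (2 ^ p) ⊕ Fin (2 ^ p)) (Fin (2 ^ p) ⊕ Fin (2 ^ p)) ℂ :=
      fun j => Matrix.fromBlocks 0 (-Complex.I • a j) (Complex.I • a j) 0
    let c : Matrix (Fin (2 ^ p) ⊕ Fin (2 ^ p)) (Fin (2 ^ p) ⊕ Fin (2 ^ p)) ℂ :=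
      Matrix.fromBlocks 0 (Complex.I • 1) (Complex.I • 1) 0
    let d : Matrix (Fin (2 ^ p) ⊕ Fin (2 ^ p)) (Fin (2 ^ p) ⊕ Fin (2 ^ p)) ℂ :=
      Matrix.fromBlocks (-Complex.I • 1) 0 0 (Complex.I • 1)
    let g : Fin (2 * (p + 1) + 1) →
        Matrix (Fin (2 ^ p) ⊕ Fin (2 ^ p)) (Fin (2 ^ p) ⊕ Fin (2 ^ p)) ℂ :=
      Fin.snoc (α := fun _ => _) (Fin.snoc (α := fun _ => _) b c) d
    have hbb : ∀ j k, b j * b k + b k * b j = (if j = k then (-2 : ℂ) else 0) • 1 := by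
      intro j k
      simp only [b, Matrix.fromBlocks_multiply, Matrix.fromBlocks_add, smul_mul_smul_comm,
        ← Matrix.fromBlocks_one, Matrix.fromBlocks_smul]
      simp [ha j k]
    have hbc : ∀ j, b j * c + c * b j = 0 := by
      intro j
      simp [b, c, Matrix.fromBlocks_multiply, Matrix.fromBlocks_add, smul_smul]
    have hbd : ∀ j, b j * d + d * b j = 0 := by
      intro j
      simp [b, d, Matrix.fromBlocks_multiply, Matrix.fromBlocks_add, smul_smul]
    have hcd : c * d + d * c = 0 := by
      simp [c, d, Matrix.fromBlocks_multiply, Matrix.fromBlocks_add, smul_smul]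
    have hcc : c * c + c * c = (-2 : ℂ) • 1 := by
      simp only [c, Matrix.fromBlocks_multiply, Matrix.fromBlocks_add, smul_mul_smul_comm,
        ← Matrix.fromBlocks_one, Matrix.fromBlocks_smul]
      simp [← two_smul ℂ]
    have hdd : d * d + d * d = (-2 : ℂ) • 1 := by
      simp only [d, Matrix.fromBlocks_multiply, Matrix.fromBlocks_add, smul_mul_smul_comm,
        ← Matrix.fromBlocks_one, Matrix.fromBlocks_smul]
      simp [← two_smul ℂ]
    have hg : ∀ j k, g j * g k + g k * g j = (if j = k then (-2 : ℂ) else 0) • 1 := by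
      intro j k
      induction j using Fin.lastCases with
      | last =>
        induction k using Fin.lastCases with
        | last => simpa [g] using hdd
        | cast k =>
          rw [if_neg (Fin.castSucc_lt_last k).ne', zero_smul]
          induction k using Fin.lastCases with
          | last => simpa [g, add_comm] using hcd
          | cast k => simpa [g, add_comm] using hbd k
      | cast j =>
        induction k using Fin.lastCases with
        | last =>
          rw [if_neg (Fin.castSucc_lt_last j).ne, zero_smul]
          induction j using Fin.lastCases with
          | last => simpa [g] using hcd
          | cast j => simpa [g] using hbd j
        | cast k =>
          simp only [Fin.castSucc_inj]
          induction j using Fin.lastCases with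
          | last =>
            induction k using Fin.lastCases with
            | last => simpa [g] using hcc
            | cast k =>
              rw [if_neg (Fin.castSucc_lt_last k).ne', zero_smul]
              simpa [g, add_comm] using hbc k
          | cast j =>
            induction k using Fin.lastCases with
            | last =>
              rw [if_neg (Fin.castSucc_lt_last j).ne, zero_smul]
              simpa [g] using hbc j
            | cast k => simpa [g, Fin.castSucc_inj] using hbb j k
    have hg' : ∀ j, (g j).conjTranspose = -g j := by
      intro j
      induction j using Fin.lastCases with
      | last => simp [g, d, Matrix.fromBlocks_conjTranspose, Matrix.fromBlocks_neg]
      | cast j =>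
        induction j using Fin.lastCases with
        | last => simp [g, c, Matrix.fromBlocks_conjTranspose, Matrix.fromBlocks_neg]
        | cast j => simp [g, b, Matrix.fromBlocks_conjTranspose, Matrix.fromBlocks_neg, ha']
    refine ⟨fun j => Matrix.reindexAlgEquiv ℂ ℂ e (g j), fun j k => ?_, fun k => ?_⟩
    · rw [← map_mul, ← map_mul, ← map_add, hg, map_smul, map_one]
    · rw [← map_neg, ← hg']
      rfl

/-- Every `ℝⁿ` has a spin representation. -/
instance (n : ℕ) : Nonempty (SpinRep n) := by
  obtain ⟨a, ha, ha'⟩ := exists_gamma (n / 2)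
  have hn : n ≤ 2 * (n / 2) + 1 := by omega
  refine ⟨⟨fun k => Matrix.toLpLinAlgEquiv 2 (a (Fin.castLE hn k)), fun j k s => ?_,
    fun k s s' => ?_⟩⟩
  · have h := congrArg (fun M => Matrix.toLpLinAlgEquiv 2 M s)
      (ha (Fin.castLE hn j) (Fin.castLE hn k))
    rw [map_smul, map_add, map_mul, map_mul, map_one] at h
    simp only [Fin.castLE_inj] at h
    exact h
  · have h := Matrix.toEuclideanLin_conjTranspose_eq_adjoint (a (Fin.castLE hn k))
    rw [ha', map_neg] at h
    have h2 := LinearMap.adjoint_inner_right (Matrix.toEuclideanLin (a (Fin.castLE hn k))) s s'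
    rw [← h] at h2
    rw [LinearMap.neg_apply, inner_neg_right] at h2
    exact h2.symm

end SpinYamabe

end

open SpinYamabe

/-! Write `a = (m-2)/2`, `p = 1/(m-1)`, `ρ = u² + v²`, `K = cosh(t)^{-p} ρ^p` and `t = -log |x|`.
The radial ansatz turns the Dirac equation into the planar system, with `|ψ(x)|² = ρ(t) |x|^{-2a}`.
Everything therefore reduces to the growth of `ρ`.

The nonlinear term is a rotation and drops out of `ρ' = 2a(v² - u²)`. Hence `ρ` stays between
multiples of `e^{±2a|t|}`: it neither blows up nor vanishes. This gives global existence (in polar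
coordinates) and smoothness; a Lipschitz estimate gives uniqueness and continuous dependence
(`dist_sq_le`).

The data `u(0) = v(0)` are fixed by `(u, v)(t) ↦ (v, u)(-t)`, so the energy is even, and it
decreases on `[0, ∞)`. Its limit thus always exists in `[-∞, ∞)`, and is negative iff the energy is
negative somewhere. Negative energy forces `uv > 0`, which leaves finitely many zeros of `v`. So the
union of the `A_k` is the set of `μ > 0` with negative energy at some time (`mem_iUnion_A_iff`):
open by continuous dependence, and containing all small `μ`.

Negative energy also gives `ρ ≤ C cosh t` (`sq_le_of_flowEnergy_neg`) and `ρ → ∞`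
(`tendsto_sq_atTop`), the upper and lower bounds for `|ψ|`. -/

/-! ### The planar system -/

/-- `(u, v)` solves `u' = K v - a u`, `v' = a v - K u` on `I`, where
`K = cosh(t)^{-p} (u² + v²)^p`. -/
structure IsFlowOn (a p : ℝ) (u v : ℝ → ℝ) (I : Set ℝ) : Prop where
  deriv_u : ∀ t ∈ I, HasDerivAt u
    (Real.cosh t ^ (-p) * (u t ^ 2 + v t ^ 2) ^ p * v t - a * u t) t
  deriv_v : ∀ t ∈ I, HasDerivAt v
    (a * v t - Real.cosh t ^ (-p) * (u t ^ 2 + v t ^ 2) ^ p * u t) t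

/-! ### Grönwall and Lipschitz estimates, uniqueness, reflection symmetry -/

/-- Grönwall: `f e^{-Lt}` is antitone. No sign is imposed on `f` or `L`, so applying it to `-ρ`
yields lower bounds. -/
theorem le_mul_exp_of_deriv_le {f f' : ℝ → ℝ} {L T : ℝ}
    (hf : ∀ t ∈ Set.Ico 0 T, HasDerivAt f (f' t) t)
    (hf' : ∀ t ∈ Set.Ico 0 T, f' t ≤ L * f t) :
    ∀ t ∈ Set.Ico 0 T, f t ≤ f 0 * Real.exp (L * t) := by
  intro t ht
  have hd : ∀ s ∈ Set.Ico 0 T, HasDerivAt (fun s => f s * Real.exp (-(L * s)))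
      (f' s * Real.exp (-(L * s)) + f s * (Real.exp (-(L * s)) * -(L * 1))) s := fun s hs =>
    (hf s hs).mul ((((hasDerivAt_id s).const_mul L).neg).exp)
  have hanti : AntitoneOn (fun s => f s * Real.exp (-(L * s))) (Set.Ico 0 T) := by
    refine antitoneOn_of_deriv_nonpos (convex_Ico 0 T)
      (fun s hs => (hd s hs).continuousAt.continuousWithinAt)
      (fun s hs => (hd s (interior_subset hs)).differentiableAt.differentiableWithinAt)
      fun s hs => ?_
    rw [(hd s (interior_subset hs)).deriv]
    have h1 := hf' s (interior_subset hs)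
    have h2 := Real.exp_pos (-(L * s))
    nlinarith
  have h := hanti ⟨le_rfl, ht.1.trans_lt ht.2⟩ ht ht.1
  simp only [mul_zero, neg_zero, Real.exp_zero, mul_one] at h
  rw [Real.exp_neg] at h
  have h2 := Real.exp_pos (L * t)
  calc f t = f t * (Real.exp (L * t))⁻¹ * Real.exp (L * t) := by field_simp
    _ ≤ _ := by gcongr

/-- As `q ≤ 1`, the function `r ↦ r^{q-1}` is nonincreasing, so `x^q y ≤ y^q x` for `y ≤ x`. The
factor `y` compensates for the unbounded slope of `r^q` at `0`. It is used with `q = 2p` and `x`,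
`y` the square roots of two values of `ρ`. -/
theorem abs_rpow_sub_rpow_mul_le {x y q : ℝ} (hx : 0 ≤ x) (hy : 0 ≤ y) (hq : 0 < q) (hq1 : q ≤ 1) :
    |x ^ q - y ^ q| * y ≤ y ^ q * |x - y| := by
  have key : ∀ {x y : ℝ}, 0 ≤ y → y ≤ x → x ^ q * y ≤ y ^ q * x := by
    intro x y hy hxy
    rcases hy.eq_or_lt with rfl | hy
    · simp [Real.zero_rpow hq.ne']
    have hx : 0 < x := hy.trans_le hxy
    have h1 : y = y ^ q * y ^ (1 - q) := by
      rw [← Real.rpow_add hy]; simp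
    have h2 : x = x ^ q * x ^ (1 - q) := by
      rw [← Real.rpow_add hx]; simp
    have h3 : y ^ (1 - q) ≤ x ^ (1 - q) := Real.rpow_le_rpow hy.le hxy (by linarith)
    calc x ^ q * y = x ^ q * y ^ q * y ^ (1 - q) := by rw [mul_assoc, ← h1]
      _ ≤ x ^ q * y ^ q * x ^ (1 - q) := by gcongr
      _ = y ^ q * (x ^ q * x ^ (1 - q)) := by ring
      _ = y ^ q * x := by rw [← h2]
  rcases le_total y x with h | h
  · have h1 : y ^ q ≤ x ^ q := Real.rpow_le_rpow hy h hq.le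
    rw [abs_of_nonneg (by linarith), abs_of_nonneg (by linarith)]
    linarith [key hy h]
  · have h1 : x ^ q ≤ y ^ q := Real.rpow_le_rpow hx h hq.le
    rw [abs_of_nonpos (by linarith), abs_of_nonpos (by linarith)]
    linarith [key hx h]

theorem abs_sqrt_sub_sqrt_le (a b c d : ℝ) :
    |√(a ^ 2 + b ^ 2) - √(c ^ 2 + d ^ 2)| ≤ √((a - c) ^ 2 + (b - d) ^ 2) := by
  have h := abs_norm_sub_norm_le (!₂[a, b] : EuclideanSpace ℝ (Fin 2)) !₂[c, d]
  simpa [EuclideanSpace.norm_eq, Fin.sum_univ_two] using h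

/-- Lipschitz estimate for the nonlinearity. -/
theorem abs_rpow_sub_rpow_mul_abs_le {p u v x y R : ℝ} (hp : 0 < p) (hp2 : p ≤ 1 / 2)
    (hR : x ^ 2 + y ^ 2 ≤ R) :
    |(u ^ 2 + v ^ 2) ^ p - (x ^ 2 + y ^ 2) ^ p| * |(u - x) * y - (v - y) * x|
      ≤ R ^ p * ((u - x) ^ 2 + (v - y) ^ 2) := by
  have h1 := abs_rpow_sub_rpow_mul_le (q := 2 * p) (Real.sqrt_nonneg (u ^ 2 + v ^ 2))
    (Real.sqrt_nonneg (x ^ 2 + y ^ 2)) (by linarith) (by linarith)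
  have e : ∀ r : ℝ, 0 ≤ r → √r ^ (2 * p) = r ^ p := fun r hr => by
    rw [Real.rpow_mul (Real.sqrt_nonneg r), Real.rpow_two, Real.sq_sqrt hr]
  rw [e _ (by positivity), e _ (by positivity)] at h1
  have h2 := abs_sqrt_sub_sqrt_le u v x y
  have h3 : |(u - x) * y - (v - y) * x|
      ≤ √(x ^ 2 + y ^ 2) * √((u - x) ^ 2 + (v - y) ^ 2) := by
    rw [← Real.sqrt_mul (by positivity)]
    refine Real.abs_le_sqrt ?_
    nlinarith [sq_nonneg ((u - x) * x + (v - y) * y)]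
  have h4 : (x ^ 2 + y ^ 2) ^ p ≤ R ^ p := Real.rpow_le_rpow (by positivity) hR hp.le
  have h5 := Real.mul_self_sqrt (show 0 ≤ (u - x) ^ 2 + (v - y) ^ 2 by positivity)
  set S := √((u - x) ^ 2 + (v - y) ^ 2)
  have hS : 0 ≤ S := Real.sqrt_nonneg _
  calc _ ≤ |(u ^ 2 + v ^ 2) ^ p - (x ^ 2 + y ^ 2) ^ p| * (√(x ^ 2 + y ^ 2) * S) := by gcongr
    _ = |(u ^ 2 + v ^ 2) ^ p - (x ^ 2 + y ^ 2) ^ p| * √(x ^ 2 + y ^ 2) * S := by ring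
    _ ≤ (x ^ 2 + y ^ 2) ^ p * |√(u ^ 2 + v ^ 2) - √(x ^ 2 + y ^ 2)| * S := by gcongr
    _ ≤ R ^ p * S * S := by
      have := (Real.rpow_nonneg (by positivity : 0 ≤ x ^ 2 + y ^ 2) p).trans h4
      gcongr
    _ = _ := by rw [mul_assoc, h5]

theorem cosh_rpow_neg_le_one {p : ℝ} (hp : 0 ≤ p) (t : ℝ) : Real.cosh t ^ (-p) ≤ 1 :=
  Real.rpow_le_one_of_one_le_of_nonpos (Real.one_le_cosh t) (by linarith)

theorem cosh_rpow_pos (p t : ℝ) : 0 < Real.cosh t ^ p :=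
  Real.rpow_pos_of_pos (Real.cosh_pos t) p

namespace IsFlowOn

variable {a p T : ℝ} {u v x y : ℝ → ℝ} {I J : Set ℝ}

theorem mono (h : IsFlowOn a p u v I) (hJ : J ⊆ I) : IsFlowOn a p u v J :=
  ⟨fun t ht => h.deriv_u t (hJ ht), fun t ht => h.deriv_v t (hJ ht)⟩

theorem reflect (h : IsFlowOn a p u v I) (hI : ∀ t ∈ I, -t ∈ I) :
    IsFlowOn a p (fun t => v (-t)) (fun t => u (-t)) I := by
  constructor <;> intro t ht <;> have ht' : -t ∈ I := hI t ht
  · have := (h.deriv_v _ ht').scomp t (hasDerivAt_neg t)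
    refine this.congr_deriv ?_
    simp only [Real.cosh_neg, smul_eq_mul]
    rw [add_comm (u (-t) ^ 2)]
    ring
  · have := (h.deriv_u _ ht').scomp t (hasDerivAt_neg t)
    refine this.congr_deriv ?_
    simp only [Real.cosh_neg, smul_eq_mul]
    rw [add_comm (u (-t) ^ 2)]
    ring

/-- The `K` terms are orthogonal to `(u, v)` and cancel. -/
theorem hasDerivAt_sq (h : IsFlowOn a p u v I) {t : ℝ} (ht : t ∈ I) :
    HasDerivAt (fun t => u t ^ 2 + v t ^ 2) (2 * a * (v t ^ 2 - u t ^ 2)) t := by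
  refine (((h.deriv_u t ht).fun_pow 2).fun_add ((h.deriv_v t ht).fun_pow 2)).congr_deriv ?_
  push_cast
  ring

theorem sq_le (ha : 0 ≤ a) (h : IsFlowOn a p u v (Set.Ico 0 T)) :
    ∀ t ∈ Set.Ico 0 T, u t ^ 2 + v t ^ 2 ≤ (u 0 ^ 2 + v 0 ^ 2) * Real.exp (2 * a * t) :=
  le_mul_exp_of_deriv_le (fun t ht => h.hasDerivAt_sq ht) fun t _ => by
    nlinarith [mul_nonneg ha (sq_nonneg (u t))]

theorem le_sq (ha : 0 ≤ a) (h : IsFlowOn a p u v (Set.Ico 0 T)) :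
    ∀ t ∈ Set.Ico 0 T, (u 0 ^ 2 + v 0 ^ 2) * Real.exp (-(2 * a) * t) ≤ u t ^ 2 + v t ^ 2 := by
  intro t ht
  have := le_mul_exp_of_deriv_le (L := -(2 * a)) (fun t ht => (h.hasDerivAt_sq ht).neg)
    (fun t _ => by
      simp only [Pi.neg_apply]
      nlinarith [mul_nonneg ha (sq_nonneg (v t))]) t ht
  simp only [Pi.neg_apply] at this
  linarith

theorem sq_pos (ha : 0 ≤ a) (h : IsFlowOn a p u v Set.univ) (h0 : 0 < u 0 ^ 2 + v 0 ^ 2) (t : ℝ) :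
    0 < u t ^ 2 + v t ^ 2 := by
  rcases le_total 0 t with ht | ht
  · exact lt_of_lt_of_le (by positivity)
      (le_sq ha (h.mono (Set.subset_univ (Set.Ico 0 (t + 1)))) t ⟨ht, by linarith⟩)
  · have := le_sq ha ((h.reflect fun _ _ => trivial).mono
      (Set.subset_univ (Set.Ico 0 (-t + 1)))) (-t) ⟨by linarith, by linarith⟩
    simp only [neg_zero, neg_neg] at this
    rw [add_comm]
    refine lt_of_lt_of_le ?_ this
    rw [add_comm] at h0
    positivity

/-- Continuous dependence on the initial value, with an explicit exponential rate. -/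
theorem dist_sq_le (ha : 0 ≤ a) (hp : 0 < p) (hp2 : p ≤ 1 / 2) {B : ℝ}
    (h : IsFlowOn a p u v (Set.Ico 0 T)) (h' : IsFlowOn a p x y (Set.Ico 0 T))
    (hB : x 0 ^ 2 + y 0 ^ 2 ≤ B) :
    ∀ t ∈ Set.Ico 0 T, (u t - x t) ^ 2 + (v t - y t) ^ 2
      ≤ ((u 0 - x 0) ^ 2 + (v 0 - y 0) ^ 2)
        * Real.exp ((2 * a + 2 * (B * Real.exp (2 * a * T)) ^ p) * t) := by
  have hd := fun t ht => (((h.deriv_u t ht).fun_sub (h'.deriv_u t ht)).fun_pow 2).fun_add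
    (((h.deriv_v t ht).fun_sub (h'.deriv_v t ht)).fun_pow 2)
  refine le_mul_exp_of_deriv_le hd fun t ht => ?_
  push_cast
  have hR : x t ^ 2 + y t ^ 2 ≤ B * Real.exp (2 * a * T) := by
    refine (h'.sq_le ha t ht).trans ?_
    have hB0 : 0 ≤ B := le_trans (by positivity) hB
    have := ht.2.le
    gcongr
  have key := abs_rpow_sub_rpow_mul_abs_le (u := u t) (v := v t) hp hp2 hR
  set g := Real.cosh t ^ (-p)
  have hg0 : 0 < g := cosh_rpow_pos _ _
  have hg1 : g ≤ 1 := cosh_rpow_neg_le_one hp.le t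
  set R := (B * Real.exp (2 * a * T)) ^ p
  set k := (u t ^ 2 + v t ^ 2) ^ p
  set l := (x t ^ 2 + y t ^ 2) ^ p
  rw [← abs_mul] at key
  have key2 : g * ((k - l) * ((u t - x t) * y t - (v t - y t) * x t))
      ≤ R * ((u t - x t) ^ 2 + (v t - y t) ^ 2) := by
    refine (mul_le_mul_of_nonneg_left (le_abs_self _) hg0.le).trans ?_
    exact (mul_le_of_le_one_left (abs_nonneg _) hg1).trans key
  -- Since `(u-x)v - (v-y)u = (u-x)y - (v-y)x`, the nonlinear contribution carries the factor `k -
  -- l`, and the remaining factor involves only the second solution. That is why only `(x, y)` needs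
  -- the bound `B`.
  have e : 2 * (u t - x t) ^ 1 * (g * k * v t - a * u t - (g * l * y t - a * x t))
      + 2 * (v t - y t) ^ 1 * (a * v t - g * k * u t - (a * y t - g * l * x t))
      = 2 * a * ((v t - y t) ^ 2 - (u t - x t) ^ 2)
        + 2 * (g * ((k - l) * ((u t - x t) * y t - (v t - y t) * x t))) := by ring
  rw [e]
  nlinarith [mul_nonneg ha (sq_nonneg (u t - x t))]

theorem eqOn_Ico (ha : 0 ≤ a) (hp : 0 < p) (hp2 : p ≤ 1 / 2)
    (h : IsFlowOn a p u v (Set.Ico 0 T)) (h' : IsFlowOn a p x y (Set.Ico 0 T))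
    (hu : u 0 = x 0) (hv : v 0 = y 0) : ∀ t ∈ Set.Ico 0 T, u t = x t ∧ v t = y t := by
  intro t ht
  have := dist_sq_le ha hp hp2 h h' le_rfl t ht
  rw [hu, hv] at this
  simp only [sub_self, ne_eq, OfNat.ofNat_ne_zero, not_false_eq_true, zero_pow, add_zero,
    zero_mul] at this
  constructor <;> nlinarith [sq_nonneg (u t - x t), sq_nonneg (v t - y t)]

theorem eqOn_Ioo (ha : 0 ≤ a) (hp : 0 < p) (hp2 : p ≤ 1 / 2)
    (h : IsFlowOn a p u v (Set.Ioo (-T) T)) (h' : IsFlowOn a p x y (Set.Ioo (-T) T))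
    (hu : u 0 = x 0) (hv : v 0 = y 0) : ∀ t ∈ Set.Ioo (-T) T, u t = x t ∧ v t = y t := by
  intro t ht
  rcases le_total 0 t with h0 | h0
  · have hs : Set.Ico 0 T ⊆ Set.Ioo (-T) T := fun s hs => ⟨by linarith [hs.1, hs.2], hs.2⟩
    exact eqOn_Ico ha hp hp2 (h.mono hs) (h'.mono hs) hu hv t ⟨h0, ht.2⟩
  · have hs : Set.Ico 0 T ⊆ Set.Ioo (-T) T := fun s hs => ⟨by linarith [hs.1, hs.2], hs.2⟩
    have hI : ∀ s ∈ Set.Ioo (-T) T, -s ∈ Set.Ioo (-T) T := fun s hs =>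
      ⟨by linarith [hs.2], by linarith [hs.1]⟩
    have := eqOn_Ico ha hp hp2 ((h.reflect hI).mono hs) ((h'.reflect hI).mono hs) (by simpa using hv)
      (by simpa using hu) (-t) ⟨by linarith, by linarith [ht.1]⟩
    simpa [and_comm] using this

theorem eq_of_zero_eq (ha : 0 ≤ a) (hp : 0 < p) (hp2 : p ≤ 1 / 2)
    (h : IsFlowOn a p u v Set.univ) (h' : IsFlowOn a p x y Set.univ)
    (hu : u 0 = x 0) (hv : v 0 = y 0) : u = x ∧ v = y := by
  have := fun t : ℝ => eqOn_Ioo (T := |t| + 1) ha hp hp2 (h.mono (Set.subset_univ _))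
    (h'.mono (Set.subset_univ _)) hu hv t (abs_lt.1 (lt_add_one _))
  exact ⟨funext fun t => (this t).1, funext fun t => (this t).2⟩

/-- The reflected pair has the same initial value, so uniqueness identifies it with the solution. -/
theorem apply_neg (ha : 0 ≤ a) (hp : 0 < p) (hp2 : p ≤ 1 / 2)
    (h : IsFlowOn a p u v Set.univ) (h0 : u 0 = v 0) (t : ℝ) : u (-t) = v t ∧ v (-t) = u t := by
  have := eq_of_zero_eq ha hp hp2 h (h.reflect fun _ _ => trivial) (by simpa using h0)
    (by simpa using h0.symm)
  exact ⟨(congrFun this.2 t).symm, (congrFun this.1 t).symm⟩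

/-- Bootstrapping: the right-hand side is as regular as `(u, v)`, because `ρ > 0` keeps the power
`ρ^p` away from its singular point. -/
theorem contDiff (ha : 0 ≤ a) (h : IsFlowOn a p u v Set.univ) (h0 : 0 < u 0 ^ 2 + v 0 ^ 2) :
    ContDiff ℝ ∞ u ∧ ContDiff ℝ ∞ v := by
  suffices ∀ n : ℕ, ContDiff ℝ n u ∧ ContDiff ℝ n v from
    ⟨contDiff_infty.2 fun n => (this n).1, contDiff_infty.2 fun n => (this n).2⟩
  have hu : deriv u = fun t => Real.cosh t ^ (-p) * (u t ^ 2 + v t ^ 2) ^ p * v t - a * u t :=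
    funext fun t => (h.deriv_u t trivial).deriv
  have hv : deriv v = fun t => a * v t - Real.cosh t ^ (-p) * (u t ^ 2 + v t ^ 2) ^ p * u t :=
    funext fun t => (h.deriv_v t trivial).deriv
  have hdu : Differentiable ℝ u := fun t => (h.deriv_u t trivial).differentiableAt
  have hdv : Differentiable ℝ v := fun t => (h.deriv_v t trivial).differentiableAt
  intro n
  induction n with
  | zero => exact ⟨contDiff_zero.2 hdu.continuous, contDiff_zero.2 hdv.continuous⟩
  | succ n ih =>
    have hK : ContDiff ℝ n fun t => Real.cosh t ^ (-p) * (u t ^ 2 + v t ^ 2) ^ p :=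
      (Real.contDiff_cosh.rpow_const_of_ne fun t => (Real.cosh_pos t).ne').mul
        (((ih.1.pow 2).add (ih.2.pow 2)).rpow_const_of_ne fun t => (h.sq_pos ha h0 t).ne')
    push_cast
    rw [contDiff_succ_iff_deriv, contDiff_succ_iff_deriv, hu, hv]
    exact ⟨⟨hdu, by simp, (hK.mul ih.2).sub (contDiff_const.mul ih.1)⟩,
      ⟨hdv, by simp, (contDiff_const.mul ih.2).sub (hK.mul ih.1)⟩⟩

end IsFlowOn

/-! ### Global existence -/

/-- Bounded truncation of the system in the coordinates `u = e^{s/2} cos θ`, `v = e^{s/2} sin θ`. -/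
noncomputable def polarField (a p R t : ℝ) (w : ℝ × ℝ) : ℝ × ℝ :=
  (-(2 * a * Real.cos (2 * w.2)),
    a * Real.sin (2 * w.2) - Real.cosh t ^ (-p) * Real.exp (p * min w.1 R))

theorem abs_exp_sub_exp_le {x y M : ℝ} (hx : x ≤ M) (hy : y ≤ M) :
    |Real.exp x - Real.exp y| ≤ Real.exp M * |x - y| := by
  wlog h : y ≤ x generalizing x y
  · rw [abs_sub_comm, abs_sub_comm x]
    exact this hy hx (le_of_not_ge h)
  have h1 : Real.exp y = Real.exp x * Real.exp (y - x) := by rw [← Real.exp_add]; ring_nf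
  rw [abs_of_nonneg (by linarith [Real.exp_le_exp.2 h]), abs_of_nonneg (by linarith)]
  calc Real.exp x - Real.exp y = Real.exp x * (1 - Real.exp (y - x)) := by rw [h1]; ring
    _ ≤ Real.exp x * (x - y) :=
        mul_le_mul_of_nonneg_left (by linarith [Real.add_one_le_exp (y - x)]) (Real.exp_pos x).le
    _ ≤ _ := by gcongr

theorem abs_cos_sub_cos_le (x y : ℝ) : |Real.cos x - Real.cos y| ≤ |x - y| := by
  simpa [Real.dist_eq] using Real.lipschitzWith_cos.dist_le_mul x y

theorem abs_sin_sub_sin_le (x y : ℝ) : |Real.sin x - Real.sin y| ≤ |x - y| := by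
  simpa [Real.dist_eq] using Real.lipschitzWith_sin.dist_le_mul x y

theorem dist_polarField_le {a p : ℝ} (ha : 0 ≤ a) (hp : 0 < p) (R t : ℝ) (w z : ℝ × ℝ) :
    dist (polarField a p R t w) (polarField a p R t z)
      ≤ (4 * a + p * Real.exp (p * R)) * dist w z := by
  have h1 : |w.1 - z.1| ≤ dist w z := by rw [Prod.dist_eq, ← Real.dist_eq]; exact le_max_left _ _
  have h2 : |w.2 - z.2| ≤ dist w z := by rw [Prod.dist_eq, ← Real.dist_eq]; exact le_max_right _ _
  have hE := Real.exp_pos (p * R)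
  have hd : 0 ≤ dist w z := dist_nonneg
  have hg0 := cosh_rpow_pos (-p) t
  have hg1 := cosh_rpow_neg_le_one hp.le t
  have h2' : |2 * w.2 - 2 * z.2| ≤ 2 * dist w z := by
    rw [← mul_sub, abs_mul, abs_two]; linarith
  rw [Prod.dist_eq]
  refine max_le ?_ ?_
  · rw [Real.dist_eq]
    simp only [polarField]
    rw [neg_sub_neg, ← mul_sub, abs_mul, abs_of_nonneg (by positivity : 0 ≤ 2 * a), abs_sub_comm]
    have h3 := abs_cos_sub_cos_le (2 * w.2) (2 * z.2)
    have : 0 ≤ p * Real.exp (p * R) * dist w z := by positivity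
    calc 2 * a * |Real.cos (2 * w.2) - Real.cos (2 * z.2)| ≤ 2 * a * (2 * dist w z) := by
          gcongr; exact h3.trans h2'
      _ ≤ _ := by linarith
  · rw [Real.dist_eq]
    simp only [polarField]
    have h3 := abs_sin_sub_sin_le (2 * w.2) (2 * z.2)
    have h4 := abs_exp_sub_exp_le (mul_le_mul_of_nonneg_left (min_le_right w.1 R) hp.le)
      (mul_le_mul_of_nonneg_left (min_le_right z.1 R) hp.le)
    have h5 : |min w.1 R - min z.1 R| ≤ |w.1 - z.1| := by
      simpa using abs_min_sub_min_le_max w.1 R z.1 R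
    rw [← mul_sub, abs_mul, abs_of_pos hp] at h4
    have e : a * Real.sin (2 * w.2) - Real.cosh t ^ (-p) * Real.exp (p * min w.1 R)
        - (a * Real.sin (2 * z.2) - Real.cosh t ^ (-p) * Real.exp (p * min z.1 R))
        = a * (Real.sin (2 * w.2) - Real.sin (2 * z.2))
          - Real.cosh t ^ (-p) * (Real.exp (p * min w.1 R) - Real.exp (p * min z.1 R)) := by ring
    rw [e]
    refine (abs_sub _ _).trans ?_
    rw [abs_mul, abs_mul, abs_of_nonneg ha, abs_of_pos hg0]
    have h6 : a * |Real.sin (2 * w.2) - Real.sin (2 * z.2)| ≤ a * (2 * dist w z) := by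
      gcongr; exact h3.trans h2'
    have h7 : Real.cosh t ^ (-p) * |Real.exp (p * min w.1 R) - Real.exp (p * min z.1 R)|
        ≤ 1 * (Real.exp (p * R) * (p * dist w z)) := by
      refine mul_le_mul hg1 (h4.trans ?_) (abs_nonneg _) zero_le_one
      gcongr
      exact h5.trans h1
    have : 0 ≤ a * dist w z := by positivity
    linarith

theorem norm_polarField_le {a p : ℝ} (ha : 0 ≤ a) (hp : 0 < p) (R t : ℝ) (w : ℝ × ℝ) :
    ‖polarField a p R t w‖ ≤ 2 * a + Real.exp (p * R) := by
  have hE := Real.exp_pos (p * R)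
  have hg0 := cosh_rpow_pos (-p) t
  have hg1 := cosh_rpow_neg_le_one hp.le t
  rw [Prod.norm_def]
  refine max_le ?_ ?_
  · simp only [polarField, Real.norm_eq_abs, abs_neg]
    rw [abs_mul, abs_of_nonneg (by positivity : 0 ≤ 2 * a)]
    nlinarith [Real.abs_cos_le_one (2 * w.2)]
  · simp only [polarField, Real.norm_eq_abs]
    refine (abs_sub _ _).trans ?_
    rw [abs_mul, abs_mul, abs_of_nonneg ha, abs_of_pos hg0, abs_of_pos (Real.exp_pos _)]
    have h1 : Real.exp (p * min w.1 R) ≤ Real.exp (p * R) := by gcongr; exact min_le_right _ _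
    have h2 : Real.cosh t ^ (-p) * Real.exp (p * min w.1 R) ≤ 1 * Real.exp (p * R) :=
      mul_le_mul hg1 h1 (Real.exp_pos _).le zero_le_one
    nlinarith [Real.abs_sin_le_one (2 * w.2)]

theorem exists_polar_solution {a p : ℝ} (ha : 0 ≤ a) (hp : 0 < p) (R : ℝ) {T : ℝ} (hT : 0 < T)
    (w₀ : ℝ × ℝ) : ∃ w : ℝ → ℝ × ℝ, w 0 = w₀ ∧
      ∀ t ∈ Set.Ioo (-T) T, HasDerivAt w (polarField a p R t (w t)) t := by
  have hE := Real.exp_pos (p * R)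
  let K : NNReal := ⟨4 * a + p * Real.exp (p * R), by positivity⟩
  let L : NNReal := ⟨2 * a + Real.exp (p * R), by positivity⟩
  let T' : NNReal := ⟨T, hT.le⟩
  -- The field is bounded by `L` everywhere, so the radius `L * T'` lets Picard–Lindelöf cover the
  -- whole interval at once.
  have hPL : IsPicardLindelof (polarField a p R) (tmin := -T) (tmax := T)
      ⟨0, by linarith, hT.le⟩ w₀ (L * T') 0 L K := by
    refine ⟨fun t _ => ?_, fun x _ => ?_, fun t _ x _ => norm_polarField_le ha hp R t x, ?_⟩
    · exact (LipschitzWith.of_dist_le_mul fun w z => dist_polarField_le ha hp R t w z).lipschitzOnWith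
    · refine Continuous.continuousOn ?_
      unfold polarField
      have : Continuous fun t => Real.cosh t ^ (-p) :=
        Real.continuous_cosh.rpow_const fun t => Or.inl (Real.cosh_pos t).ne'
      fun_prop
    · simp only [sub_zero, zero_sub, neg_neg, max_self, NNReal.coe_zero, NNReal.coe_mul]
      exact le_rfl
  obtain ⟨w, hw0, hw⟩ := hPL.exists_eq_forall_mem_Icc_hasDerivWithinAt₀
  exact ⟨w, hw0, fun t ht => (hw t (Set.Ioo_subset_Icc_self ht)).hasDerivAt
    (Icc_mem_nhds ht.1 ht.2)⟩

theorem exists_isFlowOn_Ioo {a p μ T : ℝ} (ha : 0 ≤ a) (hp : 0 < p) (hμ : 0 < μ) (hT : 0 < T) :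
    ∃ u v : ℝ → ℝ, u 0 = μ ∧ v 0 = μ ∧ IsFlowOn a p u v (Set.Ioo (-T) T) := by
  set s₀ := Real.log (2 * μ ^ 2) with hs₀
  -- Since `|s'| ≤ 2a`, the log-radius cannot exceed this level on `(-T, T)`: the truncation is
  -- never active.
  set R := s₀ + 2 * a * T
  obtain ⟨w, hw0, hw⟩ := exists_polar_solution ha hp R hT (s₀, Real.pi / 4)
  have hs : ∀ t ∈ Set.Ioo (-T) T, HasDerivAt (fun t => (w t).1) (-(2 * a * Real.cos (2 * (w t).2))) t :=
    fun t ht => (hasFDerivAt_fst (p := w t)).comp_hasDerivAt t (hw t ht)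
  have hθ : ∀ t ∈ Set.Ioo (-T) T, HasDerivAt (fun t => (w t).2)
      (a * Real.sin (2 * (w t).2) - Real.cosh t ^ (-p) * Real.exp (p * min (w t).1 R)) t :=
    fun t ht => (hasFDerivAt_snd (p := w t)).comp_hasDerivAt t (hw t ht)
  have h0 : (0 : ℝ) ∈ Set.Ioo (-T) T := ⟨by linarith, hT⟩
  have hb : ∀ t ∈ Set.Ioo (-T) T, (w t).1 ≤ R := by
    intro t ht
    have h := (convex_Ioo (-T) T).norm_image_sub_le_of_norm_hasDerivWithin_le
      (fun t ht => (hs t ht).hasDerivWithinAt) (C := 2 * a) (fun t _ => by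
        rw [norm_neg, norm_mul, Real.norm_of_nonneg (by positivity : 0 ≤ 2 * a)]
        exact mul_le_of_le_one_right (by positivity) (Real.abs_cos_le_one _)) h0 ht
    rw [hw0, sub_zero, Real.norm_eq_abs, Real.norm_eq_abs] at h
    have h1 := le_abs_self ((w t).1 - s₀)
    have h2 : |t| ≤ T := abs_le.2 ⟨ht.1.le, ht.2.le⟩
    have h3 : 2 * a * |t| ≤ 2 * a * T := by gcongr
    simp only [R]
    linarith
  have hsq : ∀ t, (Real.exp ((w t).1 / 2) * Real.cos (w t).2) ^ 2
      + (Real.exp ((w t).1 / 2) * Real.sin (w t).2) ^ 2 = Real.exp (w t).1 := fun t => by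
    rw [mul_pow, mul_pow, ← mul_add, Real.cos_sq_add_sin_sq, mul_one, ← Real.exp_nat_mul]
    congr 1; push_cast; ring
  have hpow : ∀ t ∈ Set.Ioo (-T) T, Real.exp (p * min (w t).1 R) = Real.exp (w t).1 ^ p :=
    fun t ht => by rw [min_eq_left (hb t ht), ← Real.exp_mul, mul_comm]
  have hr : Real.exp (s₀ / 2) = √2 * μ := by
    rw [Real.exp_half, hs₀, Real.exp_log (by positivity), Real.sqrt_mul (by norm_num),
      Real.sqrt_sq hμ.le]
  have hi : √2 * μ * (√2 / 2) = μ := by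
    have := Real.mul_self_sqrt (show (0 : ℝ) ≤ 2 by norm_num)
    linear_combination μ / 2 * this
  refine ⟨fun t => Real.exp ((w t).1 / 2) * Real.cos (w t).2,
    fun t => Real.exp ((w t).1 / 2) * Real.sin (w t).2, ?_, ?_, fun t ht => ?_, fun t ht => ?_⟩
  · simp only [hw0, hr, Real.cos_pi_div_four, hi]
  · simp only [hw0, hr, Real.sin_pi_div_four, hi]
  · refine ((((hs t ht).div_const 2).exp).fun_mul (hθ t ht).cos).congr_deriv ?_
    rw [hsq, hpow t ht]
    have e : Real.cos (2 * (w t).2) = 1 - 2 * Real.sin (w t).2 ^ 2 := by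
      rw [Real.cos_two_mul]; linarith [Real.sin_sq_add_cos_sq (w t).2]
    rw [e, Real.sin_two_mul]
    ring
  · refine ((((hs t ht).div_const 2).exp).fun_mul (hθ t ht).sin).congr_deriv ?_
    rw [hsq, hpow t ht, Real.cos_two_mul, Real.sin_two_mul]
    ring

theorem exists_isFlowOn_univ {a p μ : ℝ} (ha : 0 ≤ a) (hp : 0 < p) (hp2 : p ≤ 1 / 2) (hμ : 0 < μ) :
    ∃ u v : ℝ → ℝ, u 0 = μ ∧ v 0 = μ ∧ IsFlowOn a p u v Set.univ := by
  choose U V hU hV hF using fun n : ℕ =>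
    exists_isFlowOn_Ioo (T := (n : ℝ) + 1) ha hp hμ (by positivity)
  have hagree : ∀ n k : ℕ, ∀ t : ℝ, |t| < n + 1 → |t| < k + 1 → U n t = U k t ∧ V n t = V k t := by
    intro n k t hn hk
    wlog hnk : n ≤ k generalizing n k
    · have := this k n hk hn (le_of_not_ge hnk)
      exact ⟨this.1.symm, this.2.symm⟩
    have hc : (n : ℝ) ≤ k := by exact_mod_cast hnk
    exact IsFlowOn.eqOn_Ioo ha hp hp2 (hF n) ((hF k).mono
      (Set.Ioo_subset_Ioo (by linarith) (by linarith))) ((hU n).trans (hU k).symm)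
      ((hV n).trans (hV k).symm) t (abs_lt.1 hn)
  -- Glue the local solutions: near `t` the index may jump, but by uniqueness all the solutions
  -- involved agree there.
  let N : ℝ → ℕ := fun t => ⌈|t|⌉₊
  have hN : ∀ t, |t| < N t + 1 := fun t => (Nat.le_ceil |t|).trans_lt (lt_add_one _)
  have hev : ∀ t : ℝ, ∀ᶠ s in 𝓝 t, U (N s) s = U (N t) s ∧ V (N s) s = V (N t) s := by
    intro t
    have : ∀ᶠ s : ℝ in 𝓝 t, |s| < (N t : ℝ) + 1 := continuous_abs.continuousAt.eventually_lt_const (hN t)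
    filter_upwards [this] with s hs
    exact hagree _ _ s (hN s) hs
  refine ⟨fun t => U (N t) t, fun t => V (N t) t, hU _, hV _, fun t _ => ?_, fun t _ => ?_⟩
  · exact ((hF (N t)).deriv_u t (abs_lt.1 (hN t))).congr_of_eventuallyEq
      ((hev t).mono fun s hs => hs.1)
  · exact ((hF (N t)).deriv_v t (abs_lt.1 (hN t))).congr_of_eventuallyEq
      ((hev t).mono fun s hs => hs.2)

/-! ### The energy -/

/-- The Hamiltonian of the planar system. -/
noncomputable def flowEnergy (a p : ℝ) (u v : ℝ → ℝ) (t : ℝ) : ℝ :=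
  -a * (u t * v t) + 1 / (2 * (p + 1)) * Real.cosh t ^ (-p) * (u t ^ 2 + v t ^ 2) ^ (p + 1)

/-- Negativity of the energy bounds `u² + v²` and forces `u v > 0`. -/
theorem mul_pos_of_flowEnergy_neg {a p : ℝ} {u v : ℝ → ℝ} {t : ℝ} (ha : 0 < a) (hp : 0 < p)
    (h : flowEnergy a p u v t < 0) : 0 < u t * v t := by
  have : 0 ≤ 1 / (2 * (p + 1)) * Real.cosh t ^ (-p) * (u t ^ 2 + v t ^ 2) ^ (p + 1) := by
    have := cosh_rpow_pos (-p) t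
    positivity
  unfold flowEnergy at h
  by_contra! h'
  nlinarith

/-- Use `uv ≤ ρ/2` in the energy inequality and divide by `ρ/2`: this leaves `ρ^p < a(p+1)
cosh(t)^p`. -/
theorem sq_le_of_flowEnergy_neg {a p : ℝ} {u v : ℝ → ℝ} {t : ℝ} (ha : 0 < a) (hp : 0 < p)
    (h : flowEnergy a p u v t < 0) :
    u t ^ 2 + v t ^ 2 ≤ (a * (p + 1)) ^ (1 / p) * Real.cosh t := by
  have hpos := mul_pos_of_flowEnergy_neg ha hp h
  have hρ : 0 < u t ^ 2 + v t ^ 2 := by nlinarith [sq_nonneg (u t - v t)]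
  have hc := Real.cosh_pos t
  unfold flowEnergy at h
  rw [Real.rpow_add_one hρ.ne', Real.rpow_neg hc.le] at h
  have hcp : 0 < Real.cosh t ^ p := Real.rpow_pos_of_pos hc p
  set ρ := u t ^ 2 + v t ^ 2 with hρd
  have h1 : 1 / (2 * (p + 1)) * (Real.cosh t ^ p)⁻¹ * (ρ ^ p * ρ) < a * ρ / 2 := by
    nlinarith [sq_nonneg (u t - v t)]
  have h2 : ρ ^ p ≤ a * (p + 1) * Real.cosh t ^ p := by
    have e : 1 / (2 * (p + 1)) * (Real.cosh t ^ p)⁻¹ * (ρ ^ p * ρ)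
        = ρ ^ p / ((p + 1) * Real.cosh t ^ p) * (ρ / 2) := by field_simp
    rw [e, mul_div_assoc] at h1
    have h3 := lt_of_mul_lt_mul_right h1 (by positivity)
    rw [div_lt_iff₀ (by positivity)] at h3
    linarith
  calc ρ = (ρ ^ p) ^ (1 / p) := by rw [← Real.rpow_mul hρ.le, mul_one_div_cancel hp.ne', Real.rpow_one]
    _ ≤ (a * (p + 1) * Real.cosh t ^ p) ^ (1 / p) := by gcongr
    _ = _ := by
      rw [Real.mul_rpow (by positivity) hcp.le, ← Real.rpow_mul hc.le, mul_one_div_cancel hp.ne',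
        Real.rpow_one]

theorem continuous_flowEnergy {a p : ℝ} (hp : 0 < p) {u v : ℝ → ℝ} (hu : Continuous u)
    (hv : Continuous v) : Continuous (flowEnergy a p u v) := by
  unfold flowEnergy
  have h1 : Continuous fun t => Real.cosh t ^ (-p) :=
    Real.continuous_cosh.rpow_const fun t => Or.inl (Real.cosh_pos t).ne'
  have h2 : Continuous fun t => (u t ^ 2 + v t ^ 2) ^ (p + 1) :=
    ((hu.pow 2).add (hv.pow 2)).rpow_const fun t => Or.inr (by linarith)
  fun_prop

namespace IsFlowOn

variable {a p T : ℝ} {u v : ℝ → ℝ}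

theorem continuous_left (h : IsFlowOn a p u v Set.univ) : Continuous u :=
  continuous_iff_continuousAt.2 fun t => (h.deriv_u t trivial).continuousAt

theorem continuous_right (h : IsFlowOn a p u v Set.univ) : Continuous v :=
  continuous_iff_continuousAt.2 fun t => (h.deriv_v t trivial).continuousAt

/-- The system is Hamiltonian, so only the explicit time dependence through `cosh(t)^{-p}`
contributes. -/
theorem hasDerivAt_flowEnergy (ha : 0 ≤ a) (hp : 0 < p) (h : IsFlowOn a p u v Set.univ)
    (h0 : 0 < u 0 ^ 2 + v 0 ^ 2) (t : ℝ) :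
    HasDerivAt (flowEnergy a p u v)
      (-(p / (2 * (p + 1)) * (Real.sinh t / Real.cosh t)
        * (Real.cosh t ^ (-p) * (u t ^ 2 + v t ^ 2) ^ p * (u t ^ 2 + v t ^ 2)))) t := by
  have hρ := h.sq_pos ha h0 t
  have hc := Real.cosh_pos t
  have h1 := ((h.deriv_u t trivial).fun_mul (h.deriv_v t trivial)).const_mul (-a)
  have h2 := ((Real.hasDerivAt_cosh t).rpow_const (p := -p) (Or.inl hc.ne')).const_mul
    (1 / (2 * (p + 1)))
  have h3 := (h.hasDerivAt_sq (Set.mem_univ t)).rpow_const (p := p + 1) (Or.inl hρ.ne')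
  refine (h1.fun_add (h2.fun_mul h3)).congr_deriv ?_
  rw [Real.rpow_sub_one hc.ne', add_sub_cancel_right, Real.rpow_add_one hρ.ne']
  field_simp
  ring

theorem flowEnergy_antitoneOn (ha : 0 ≤ a) (hp : 0 < p) (h : IsFlowOn a p u v Set.univ)
    (h0 : 0 < u 0 ^ 2 + v 0 ^ 2) : AntitoneOn (flowEnergy a p u v) (Set.Ici 0) := by
  refine antitoneOn_of_deriv_nonpos (convex_Ici 0)
    (continuous_flowEnergy hp h.continuous_left h.continuous_right).continuousOn
    (fun t _ => (h.hasDerivAt_flowEnergy ha hp h0 t).differentiableAt.differentiableWithinAt)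
    fun t ht => ?_
  rw [(h.hasDerivAt_flowEnergy ha hp h0 t).deriv]
  have hρ := h.sq_pos ha h0 t
  have hc := Real.cosh_pos t
  have hs : 0 ≤ Real.sinh t := Real.sinh_nonneg_iff.2 (interior_subset ht)
  have := cosh_rpow_pos (-p) t
  rw [neg_nonpos]
  positivity

theorem flowEnergy_abs (ha : 0 ≤ a) (hp : 0 < p) (hp2 : p ≤ 1 / 2)
    (h : IsFlowOn a p u v Set.univ) (h0 : u 0 = v 0) (t : ℝ) :
    flowEnergy a p u v |t| = flowEnergy a p u v t := by
  rcases abs_choice t with ht | ht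
  · rw [ht]
  · obtain ⟨h1, h2⟩ := h.apply_neg ha hp hp2 h0 t
    rw [ht, flowEnergy, flowEnergy, h1, h2, Real.cosh_neg, mul_comm (v t), add_comm (v t ^ 2)]

theorem flowEnergy_tendsto (ha : 0 ≤ a) (hp : 0 < p) (hp2 : p ≤ 1 / 2)
    (h : IsFlowOn a p u v Set.univ) (h0 : 0 < u 0 ^ 2 + v 0 ^ 2) (huv : u 0 = v 0)
    (hT : flowEnergy a p u v T < 0) :
    ∃ L : EReal, L < 0 ∧
      Tendsto (fun t => (flowEnergy a p u v t : EReal)) (cocompact ℝ) (𝓝 L) := by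
  -- Freezing the energy on the negative axis gives a function antitone on all of `ℝ`; its infimum
  -- in `EReal`, possibly `-∞`, is the limit, and evenness transfers it to both ends.
  let e : ℝ → EReal := fun t => (flowEnergy a p u v (max t 0) : EReal)
  have he : Antitone e := fun s t hst => EReal.coe_le_coe_iff.2
    (h.flowEnergy_antitoneOn ha hp h0 (Set.mem_Ici.2 (le_max_right s 0))
      (Set.mem_Ici.2 (le_max_right t 0))
      (max_le_max_right 0 hst))
  have hee : ∀ t, e |t| = flowEnergy a p u v t := fun t => by
    simp only [e, max_eq_left (abs_nonneg t), h.flowEnergy_abs ha hp hp2 huv]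
  refine ⟨⨅ t, e t, (iInf_le e |T|).trans_lt ?_, ?_⟩
  · rw [hee]
    exact_mod_cast hT
  · have := (tendsto_atTop_iInf he).comp (tendsto_norm_cocompact_atTop (E := ℝ))
    refine this.congr fun t => ?_
    simp only [Function.comp, Real.norm_eq_abs, hee]

theorem flowEnergy_neg_of_le (ha : 0 ≤ a) (hp : 0 < p) (h : IsFlowOn a p u v Set.univ)
    (h0 : 0 < u 0 ^ 2 + v 0 ^ 2) (hT0 : 0 ≤ T) (hT : flowEnergy a p u v T < 0) {t : ℝ}
    (ht : T ≤ t) : flowEnergy a p u v t < 0 :=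
  (h.flowEnergy_antitoneOn ha hp h0 hT0 (hT0.trans ht) ht).trans_lt hT

/-- Once the energy is negative, the solution is unbounded: `v² - u²` minus a large multiple of the
energy grows at least linearly. -/
theorem tendsto_sq_atTop (ha : 0 < a) (hp : 0 < p) (h : IsFlowOn a p u v Set.univ)
    (h0 : 0 < u 0 ^ 2 + v 0 ^ 2) (hT0 : 0 ≤ T) (hT : flowEnergy a p u v T < 0) :
    Tendsto (fun t => u t ^ 2 + v t ^ 2) atTop atTop := by
  set c := -flowEnergy a p u v T
  have hc : 0 < c := neg_pos.2 hT
  -- With this `B`, the derivative of `-B H` is `4 tanh(t) K ρ`. Once `tanh t ≥ 1/2` this dominates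
  -- the term `4Kuv` in `(v² - u²)' = 2aρ - 4Kuv`.
  set B := 8 * (p + 1) / p with hB
  have hBpos : 0 < B := by positivity
  have hE : ∀ t, -flowEnergy a p u v t ≤ a * (u t ^ 2 + v t ^ 2) / 2 := fun t => by
    have : 0 ≤ 1 / (2 * (p + 1)) * Real.cosh t ^ (-p) * (u t ^ 2 + v t ^ 2) ^ (p + 1) := by
      have := cosh_rpow_pos (-p) t
      positivity
    unfold flowEnergy
    nlinarith [sq_nonneg (u t - v t)]
  -- From `t ≥ 1` on, `cosh t - sinh t ≤ 1 ≤ sinh t`, whence `tanh t ≥ 1/2`.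
  set S := max T 1
  have hd := fun t => (((((h.deriv_v t trivial).fun_pow 2).fun_sub
    ((h.deriv_u t trivial).fun_pow 2)).fun_sub
      ((h.hasDerivAt_flowEnergy ha.le hp h0 t).const_mul B))).fun_sub
        ((hasDerivAt_id t).const_mul (4 * c))
  have hmono : MonotoneOn (fun t => v t ^ 2 - u t ^ 2 - B * flowEnergy a p u v t - 4 * c * t)
      (Set.Ici S) := by
    refine monotoneOn_of_deriv_nonneg (convex_Ici S)
      (fun t _ => (hd t).continuousAt.continuousWithinAt)
      (fun t _ => (hd t).differentiableAt.differentiableWithinAt) fun t ht => ?_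
    have ht' : S ≤ t := interior_subset ht
    have h1 : 1 ≤ t := (le_max_right _ _).trans ht'
    have h2 : T ≤ t := (le_max_left _ _).trans ht'
    refine le_of_le_of_eq ?_ (hd t).deriv.symm
    have hch := Real.cosh_pos t
    have hsh : 1 / 2 ≤ Real.sinh t / Real.cosh t := by
      rw [le_div_iff₀ hch]
      have e1 := Real.self_le_sinh_iff.2 (zero_le_one.trans h1)
      have e2 := Real.cosh_sub_sinh t
      have e3 : Real.exp (-t) ≤ 1 := Real.exp_le_one_iff.2 (by linarith)
      linarith
    have hρ := h.sq_pos ha.le h0 t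
    have hEt : 4 * c ≤ 2 * a * (u t ^ 2 + v t ^ 2) := by
      have := h.flowEnergy_antitoneOn ha.le hp h0 hT0 (hT0.trans h2) h2
      have := hE t
      simp only [c]
      linarith
    have hK : 0 ≤ Real.cosh t ^ (-p) * (u t ^ 2 + v t ^ 2) ^ p := by
      have := cosh_rpow_pos (-p) t
      positivity
    set K := Real.cosh t ^ (-p) * (u t ^ 2 + v t ^ 2) ^ p
    set τ := Real.sinh t / Real.cosh t
    have hBτ : B * -(p / (2 * (p + 1)) * τ * (K * (u t ^ 2 + v t ^ 2)))
        = -(4 * τ * (K * (u t ^ 2 + v t ^ 2))) := by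
      rw [hB]; field_simp; ring
    rw [hBτ]
    have h3 : 1 / 2 * (K * (u t ^ 2 + v t ^ 2)) ≤ τ * (K * (u t ^ 2 + v t ^ 2)) := by gcongr
    have h4 : 0 ≤ K * (u t - v t) ^ 2 := by positivity
    norm_num
    nlinarith
  have hlin : Tendsto (fun t => (1 + B * a / 2)⁻¹ *
      (4 * c * t + (v S ^ 2 - u S ^ 2 - B * flowEnergy a p u v S - 4 * c * S))) atTop atTop :=
    Tendsto.const_mul_atTop (by positivity) (tendsto_atTop_add_const_right _ _
      (Tendsto.const_mul_atTop (by positivity) tendsto_id))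
  refine tendsto_atTop_mono' _ ?_ hlin
  filter_upwards [eventually_ge_atTop S] with t ht
  have h1 := hmono Set.self_mem_Ici ht ht
  simp only at h1
  rw [inv_mul_le_iff₀ (by positivity)]
  have h2 := mul_le_mul_of_nonneg_left (hE t) hBpos.le
  nlinarith [sq_nonneg (u t)]

/-- After `T` the energy is negative and `uv > 0`, so the zeros lie in `[0, T]`. At an accumulation
point `v` and `v'` would both vanish, forcing `u = 0` against `ρ > 0`. -/
theorem finite_zeros (ha : 0 < a) (hp : 0 < p) (h : IsFlowOn a p u v Set.univ)
    (h0 : 0 < u 0 ^ 2 + v 0 ^ 2) (hT0 : 0 ≤ T) (hT : flowEnergy a p u v T < 0) :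
    (Set.Ioi 0 ∩ {t | v t = 0}).Finite := by
  by_contra hinf
  have hsub : Set.Ioi 0 ∩ {t | v t = 0} ⊆ Set.Icc 0 T := by
    rintro t ⟨ht, hvt⟩
    refine ⟨le_of_lt ht, le_of_not_gt fun hlt => ?_⟩
    have := mul_pos_of_flowEnergy_neg ha hp (h.flowEnergy_neg_of_le ha.le hp h0 hT0 hT hlt.le)
    rw [show v t = 0 from hvt, mul_zero] at this
    exact this.false
  obtain ⟨x, -, hx⟩ := Set.Infinite.exists_accPt_of_subset_isCompact hinf isCompact_Icc hsub
  have hx' := accPt_iff_frequently.1 hx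
  have hvx : v x = 0 := by
    by_contra hne
    have := h.continuous_right.continuousAt.eventually_ne hne
    exact hx' (this.mono fun t ht hmem => ht hmem.2.2)
  have hux : 0 < u x ^ 2 := by simpa [hvx] using h.sq_pos ha.le h0 x
  have hux' : u x ≠ 0 := fun hz => by simp [hz] at hux
  have hd : a * v x - Real.cosh x ^ (-p) * (u x ^ 2 + v x ^ 2) ^ p * u x ≠ 0 := by
    rw [hvx, mul_zero, zero_sub, neg_ne_zero]
    have := cosh_rpow_pos (-p) x
    have : 0 < u x ^ 2 + 0 ^ 2 := by simpa using hux
    exact mul_ne_zero (by positivity) hux'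
  have := eventually_nhdsWithin_iff.1 ((h.deriv_v x trivial).eventually_ne (c := 0) hd)
  exact hx' (this.mono fun t ht hmem => ht hmem.1 hmem.2.2)

end IsFlowOn

/-! ### Counting sign changes -/

/-- The intermediate value theorem puts a zero strictly between consecutive sample points; these
zeros are distinct. -/
theorem Alternates.le_card_zeros {g : ℝ → ℝ} {s : Set ℝ} {k : ℕ} (hg : Continuous g)
    (hs : s.OrdConnected) (hfin : (s ∩ {t | g t = 0}).Finite) (h : Alternates g s k) :
    k ≤ Nat.card ↥(s ∩ {t | g t = 0}) := by
  obtain ⟨t, ht, hts, hsign⟩ := h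
  have hz : ∀ i : Fin k, ∃ z ∈ Set.Ioo (t i.castSucc) (t i.succ), g z = 0 := by
    intro i
    have hlt : t i.castSucc < t i.succ := ht (Fin.castSucc_lt_succ)
    rcases mul_neg_iff.1 (hsign i) with ⟨h1, h2⟩ | ⟨h1, h2⟩
    · obtain ⟨z, hz, hz0⟩ := intermediate_value_Ioo' hlt.le hg.continuousOn ⟨h2, h1⟩
      exact ⟨z, hz, hz0⟩
    · obtain ⟨z, hz, hz0⟩ := intermediate_value_Ioo hlt.le hg.continuousOn ⟨h1, h2⟩
      exact ⟨z, hz, hz0⟩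
  choose z hz hz0 using hz
  have hmono : StrictMono z := fun i j hij => by
    have : t i.succ ≤ t j.castSucc := ht.monotone (by
      rw [Fin.le_def]; simpa using Nat.succ_le_of_lt hij)
    exact (hz i).2.trans_le (this.trans (hz j).1.le)
  have : Finite ↥(s ∩ {t | g t = 0}) := hfin
  have := Nat.card_le_card_of_injective
    (fun i => (⟨z i, hs.out (hts _) (hts _) (Set.Ioo_subset_Icc_self (hz i)), hz0 i⟩ :
      ↥(s ∩ {t | g t = 0}))) fun i j hij => hmono.injective (congrArg Subtype.val hij)
  rwa [Nat.card_eq_fintype_card, Fintype.card_fin] at this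

theorem exists_changesSign {g : ℝ → ℝ} {s : Set ℝ} (hg : Continuous g) (hs : s.OrdConnected)
    (hne : s.Nonempty) (hfin : (s ∩ {t | g t = 0}).Finite) : ∃ k, ChangesSign g s k := by
  classical
  have hex : ∃ k, ¬Alternates g s k := ⟨_, fun h =>
    (Nat.lt_succ_self _).not_ge (Alternates.le_card_zeros hg hs hfin h)⟩
  obtain ⟨x, hx⟩ := hne
  have h0 : Alternates g s 0 :=
    ⟨fun _ => x, fun i j hij => absurd hij (by simp [Subsingleton.elim (α := Fin 1) i j]),
      fun _ => hx, fun i => i.elim0⟩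
  have hpos : Nat.find hex ≠ 0 := fun h => Nat.find_spec hex (h ▸ h0)
  refine ⟨Nat.find hex - 1, not_not.1 (Nat.find_min hex (by omega)), ?_⟩
  rw [Nat.sub_add_cancel (Nat.pos_of_ne_zero hpos)]
  exact Nat.find_spec hex

/-! ### Clifford multiplication and the Dirac operator on radial spinors -/

namespace SpinYamabe.SpinRep

variable {n : ℕ} (S : SpinRep n)

theorem mul_mul_self (x : EuclideanSpace ℝ (Fin n)) (s : Spinor n) :
    S.mul x (S.mul x s) = -(‖x‖ ^ 2) • s := by
  have e : S.mul x (S.mul x s) = ∑ j, ∑ k, (x j * x k) • S.α j (S.α k s) := by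
    simp only [mul, map_sum, LinearMap.map_smul_of_tower, Finset.smul_sum, smul_smul]
  have e' : S.mul x (S.mul x s) = ∑ j, ∑ k, (x j * x k) • S.α k (S.α j s) := by
    rw [e, Finset.sum_comm]
    simp only [mul_comm]
  -- Doubling symmetrizes the double sum, so that the Clifford relation kills all off-diagonal
  -- terms.
  have h2 : (2 : ℝ) • S.mul x (S.mul x s) = (2 : ℝ) • (-(‖x‖ ^ 2) • s) := by
    rw [two_smul]
    nth_rewrite 1 [e]
    rw [e', ← Finset.sum_add_distrib, EuclideanSpace.norm_sq_eq, smul_smul, mul_neg, Finset.mul_sum,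
      ← Finset.sum_neg_distrib, Finset.sum_smul]
    refine Finset.sum_congr rfl fun j _ => ?_
    rw [← Finset.sum_add_distrib, Finset.sum_eq_single j]
    · rw [← smul_add, S.clifford, if_pos rfl,
        show (-2 : ℂ) • s = (-2 : ℝ) • s by rw [← Complex.coe_smul]; norm_num, smul_smul]
      congr 1
      rw [Real.norm_eq_abs, sq_abs]
      ring
    · intro k _ hk
      rw [← smul_add, S.clifford, if_neg hk.symm, zero_smul, smul_zero]
    · simp
  exact smul_right_injective _ (two_ne_zero (α := ℝ)) h2

theorem inner_mul_left (x : EuclideanSpace ℝ (Fin n)) (s s' : Spinor n) :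
    inner ℂ (S.mul x s) s' = -inner ℂ s (S.mul x s') := by
  simp only [mul, sum_inner, inner_sum, ← Finset.sum_neg_distrib]
  refine Finset.sum_congr rfl fun k _ => ?_
  rw [← Complex.coe_smul, ← Complex.coe_smul, inner_smul_left, inner_smul_right, S.skew]
  simp

/-- Skewness makes this inner product purely imaginary; the two parts of the ansatz are thus
orthogonal over `ℝ`. -/
theorem re_inner_mul_self (x : EuclideanSpace ℝ (Fin n)) (s : Spinor n) :
    (inner ℂ s (S.mul x s)).re = 0 := by
  have h := congrArg Complex.re (S.inner_mul_left x s s)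
  rw [← inner_conj_symm, Complex.conj_re, Complex.neg_re] at h
  linarith

theorem norm_mul (x : EuclideanSpace ℝ (Fin n)) (s : Spinor n) :
    ‖S.mul x s‖ = ‖x‖ * ‖s‖ := by
  have h : ((‖S.mul x s‖ ^ 2 : ℝ) : ℂ) = ((‖x‖ * ‖s‖) ^ 2 : ℝ) := by
    have h1 := inner_self_eq_norm_sq_to_K (𝕜 := ℂ) (S.mul x s)
    have h2 := inner_self_eq_norm_sq_to_K (𝕜 := ℂ) s
    rw [inner_mul_left, mul_mul_self, ← Complex.coe_smul, inner_smul_right, h2] at h1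
    push_cast at h1 ⊢
    simp only [Complex.coe_algebraMap] at h1
    rw [← h1]
    ring
  exact (sq_eq_sq₀ (norm_nonneg _) (by positivity)).1 (by exact_mod_cast h)

theorem norm_smul_add_smul_mul (x : EuclideanSpace ℝ (Fin n)) (s : Spinor n) (b c : ℝ) :
    ‖b • s + c • S.mul x s‖ ^ 2 = (b ^ 2 + c ^ 2 * ‖x‖ ^ 2) * ‖s‖ ^ 2 := by
  rw [@norm_add_sq ℂ, norm_smul, norm_smul, norm_mul]
  have : RCLike.re (inner ℂ (b • s) (c • S.mul x s)) = 0 := by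
    rw [← Complex.coe_smul, ← Complex.coe_smul, inner_smul_left, inner_smul_right]
    simp [S.re_inner_mul_self x s]
  rw [this, mul_pow, mul_pow, mul_pow, Real.norm_eq_abs, Real.norm_eq_abs, sq_abs, sq_abs]
  ring

/-- `x ↦ x · s` as a continuous linear map. -/
noncomputable def mulCLM (s : Spinor n) : EuclideanSpace ℝ (Fin n) →L[ℝ] Spinor n :=
  ∑ k, (EuclideanSpace.proj k : EuclideanSpace ℝ (Fin n) →L[ℝ] ℝ).smulRight (S.α k s)

theorem mulCLM_apply (s : Spinor n) (x : EuclideanSpace ℝ (Fin n)) :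
    S.mulCLM s x = S.mul x s := by
  simp [mulCLM, mul]

theorem mul_single (k : Fin n) (s : Spinor n) :
    S.mul (EuclideanSpace.single k 1) s = S.α k s := by
  rw [mul, Finset.sum_eq_single k]
  · simp
  · intro j _ hj
    simp [hj]
  · simp

theorem alpha_alpha_self (k : Fin n) (s : Spinor n) : S.α k (S.α k s) = -s := by
  have := S.mul_mul_self (EuclideanSpace.single k 1) s
  simpa [mul_single] using this

end SpinYamabe.SpinRep

theorem hasFDerivAt_norm_euclidean {n : ℕ} {x : EuclideanSpace ℝ (Fin n)} (hx : x ≠ 0) :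
    HasFDerivAt (fun y : EuclideanSpace ℝ (Fin n) => ‖y‖) (‖x‖⁻¹ • innerSL ℝ x) x := by
  have h0 : ‖x‖ ≠ 0 := norm_ne_zero_iff.2 hx
  have h := (hasStrictFDerivAt_norm_sq x).hasFDerivAt.sqrt (pow_ne_zero 2 h0)
  simp only [Real.sqrt_sq (norm_nonneg _)] at h
  refine h.congr_fderiv ?_
  rw [← Nat.cast_smul_eq_nsmul ℝ, smul_smul]
  congr 1
  push_cast
  field_simp

/-- Differentiating the vector `x` contributes `∑ αₖ αₖ = -n`, and the radial derivative of `f₂/r`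
meets `x · x · γ = -r² γ`; together they give the coefficient `n - 1`. -/
theorem dirac_ansatz {n : ℕ} (S : SpinRep n) (γ : Spinor n) {f₁ f₂ : ℝ → ℝ} {d₁ d₂ : ℝ}
    {x : EuclideanSpace ℝ (Fin n)} (hx : x ≠ 0) (h₁ : HasDerivAt f₁ d₁ ‖x‖)
    (h₂ : HasDerivAt f₂ d₂ ‖x‖) :
    S.dirac (ansatz S γ f₁ f₂) x
      = (d₁ / ‖x‖) • S.mul x γ - (d₂ + ((n : ℝ) - 1) * f₂ ‖x‖ / ‖x‖) • γ := by
  have h0 : ‖x‖ ≠ 0 := norm_ne_zero_iff.2 hx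
  have hN := hasFDerivAt_norm_euclidean hx
  have hm : HasFDerivAt (fun y => S.mul y γ) (S.mulCLM γ) x := by
    simpa only [← S.mulCLM_apply] using (S.mulCLM γ).hasFDerivAt
  have hψ := ((h₁.comp_hasFDerivAt x hN).smul_const γ).fun_add
    (((h₂.fun_div (hasDerivAt_id _) h0).comp_hasFDerivAt x hN).fun_smul hm)
  have hψ' : fderiv ℝ (ansatz S γ f₁ f₂) x = _ := HasFDerivAt.fderiv hψ
  have hk : ∀ k, S.α k (fderiv ℝ (ansatz S γ f₁ f₂) x (EuclideanSpace.single k 1))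
      = (d₁ / ‖x‖) • (x k • S.α k γ)
        + ((d₂ - f₂ ‖x‖ / ‖x‖) / ‖x‖ ^ 2) • (x k • S.α k (S.mul x γ))
        - (f₂ ‖x‖ / ‖x‖) • γ := by
    intro k
    rw [hψ']
    simp only [add_apply, smul_apply,
      ContinuousLinearMap.smulRight_apply, innerSL_apply_apply, S.mulCLM_apply, S.mul_single, map_add,
      LinearMap.map_smul_of_tower, S.alpha_alpha_self, EuclideanSpace.inner_single_right,
      smul_eq_mul, Function.comp_apply, id]
    simp only [smul_smul, smul_neg]
    have e1 : d₁ * (‖x‖⁻¹ * (1 * (starRingEnd ℝ) (x k))) = d₁ / ‖x‖ * x k := by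
      simp; ring
    have e2 : (d₂ * ‖x‖ - f₂ ‖x‖ * 1) / ‖x‖ ^ 2 * (‖x‖⁻¹ * (1 * (starRingEnd ℝ) (x k)))
        = (d₂ - f₂ ‖x‖ / ‖x‖) / ‖x‖ ^ 2 * x k := by
      simp; field_simp
    rw [e1, e2]
    abel
  unfold SpinRep.dirac
  simp only [hk, Finset.sum_sub_distrib, Finset.sum_add_distrib, ← Finset.smul_sum]
  have e1 : ∑ k, x k • S.α k γ = S.mul x γ := rfl
  have e2 : ∑ k, x k • S.α k (S.mul x γ) = S.mul x (S.mul x γ) := rfl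
  rw [e1, e2, S.mul_mul_self, smul_smul, Finset.sum_const, Finset.card_univ, Fintype.card_fin,
    ← Nat.cast_smul_eq_nsmul ℝ, smul_smul, add_sub_assoc, ← sub_smul, sub_eq_add_neg _ (_ • γ),
    ← neg_smul]
  congr 2
  field_simp
  ring

/-! ### The spinor of a solution of the planar system -/

section spinorOf

variable {m : ℕ} (S : SpinRep (m - 1)) {γ₀ : Spinor (m - 1)} {u v : ℝ → ℝ}
  {x : EuclideanSpace ℝ (Fin (m - 1))}

theorem exp_mul_neg_log {r : ℝ} (hr : 0 < r) (a : ℝ) : Real.exp (a * -Real.log r) = r ^ (-a) := by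
  rw [Real.rpow_def_of_pos hr]
  ring_nf

theorem norm_spinorOf (hγ₀ : ‖γ₀‖ = 1) (hx : x ≠ 0) :
    ‖spinorOf m S γ₀ u v x‖ = √(u (-Real.log ‖x‖) ^ 2 + v (-Real.log ‖x‖) ^ 2)
      * ‖x‖ ^ (-(((m : ℝ) - 2) / 2)) := by
  have hr : 0 < ‖x‖ := norm_pos_iff.2 hx
  have hra : 0 < ‖x‖ ^ (-(((m : ℝ) - 2) / 2)) := Real.rpow_pos_of_pos hr _
  rw [← sq_eq_sq₀ (norm_nonneg _) (by positivity), mul_pow, Real.sq_sqrt (by positivity)]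
  simp only [spinorOf, ansatz, S.norm_smul_add_smul_mul, hγ₀, exp_mul_neg_log hr]
  field_simp

theorem spinorOf_contDiffOn (hu : ContDiff ℝ ∞ u) (hv : ContDiff ℝ ∞ v) :
    ContDiffOn ℝ ∞ (spinorOf m S γ₀ u v) {0}ᶜ := by
  intro x hx
  have hx0 : x ≠ 0 := hx
  refine ContDiffAt.contDiffWithinAt ?_
  have hr : ContDiffAt ℝ ∞ (fun y : EuclideanSpace ℝ (Fin (m - 1)) => ‖y‖) x := contDiffAt_id.norm ℝ hx0
  have ht : ContDiffAt ℝ ∞ (fun y : EuclideanSpace ℝ (Fin (m - 1)) => -Real.log ‖y‖) x :=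
    (hr.log (norm_ne_zero_iff.2 hx0)).neg
  have he : ContDiffAt ℝ ∞ (fun y : EuclideanSpace ℝ (Fin (m - 1)) =>
      Real.exp (((m : ℝ) - 2) / 2 * -Real.log ‖y‖)) x := (contDiffAt_const.mul ht).exp
  have hm : ContDiffAt ℝ ∞ (fun y => S.mul y γ₀) x := by
    simpa only [← S.mulCLM_apply] using (S.mulCLM γ₀).contDiff.contDiffAt
  have hu' := (hu.contDiffAt (x := -Real.log ‖x‖)).comp x ht
  have hv' := (hv.contDiffAt (x := -Real.log ‖x‖)).comp x ht
  exact ((hu'.neg.mul he).smul contDiffAt_const).add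
    (((hv'.mul he).div hr (norm_ne_zero_iff.2 hx0)).smul hm)

theorem dirac_spinorOf (hm : 3 ≤ m) (hγ₀ : ‖γ₀‖ = 1)
    (h : IsFlowOn (((m : ℝ) - 2) / 2) (1 / ((m : ℝ) - 1)) u v Set.univ)
    (hx : x ≠ 0) :
    S.dirac (spinorOf m S γ₀ u v) x = (weight x ^ (1 / ((m : ℝ) - 1))
      * ‖spinorOf m S γ₀ u v x‖ ^ (2 / ((m : ℝ) - 1))) • spinorOf m S γ₀ u v x := by
  have hm' : (3 : ℝ) ≤ m := by exact_mod_cast hm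
  have hr : 0 < ‖x‖ := norm_pos_iff.2 hx
  set r := ‖x‖ with hrdef
  set a := ((m : ℝ) - 2) / 2 with ha
  set p := 1 / ((m : ℝ) - 1) with hp
  have hap : p * (1 + 2 * a) = 1 := by
    have : (m : ℝ) - 1 ≠ 0 := by linarith
    rw [hp, ha]; field_simp; ring
  clear_value a p
  have hψ : spinorOf m S γ₀ u v = ansatz S γ₀ (fun s => -u (-Real.log s) * Real.exp (a * -Real.log s))
      fun s => v (-Real.log s) * Real.exp (a * -Real.log s) := by rw [ha]; rfl
  have h2p : 2 / ((m : ℝ) - 1) = 2 * p := by rw [hp]; ring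
  set t := -Real.log r with ht
  set K := Real.cosh t ^ (-p) * (u t ^ 2 + v t ^ 2) ^ p with hK
  set e := Real.exp (a * t) with he
  have hF : weight x ^ p * ‖spinorOf m S γ₀ u v x‖ ^ (2 / ((m : ℝ) - 1)) = K / r := by
    have hρ : 0 ≤ u t ^ 2 + v t ^ 2 := by positivity
    have hc := Real.cosh_pos t
    have hw : weight x = (r * Real.cosh t)⁻¹ := by
      rw [weight, ht, Real.cosh_neg, Real.cosh_log hr]
      field_simp
      ring
    rw [norm_spinorOf S hγ₀ hx, ← ha, ← hrdef, ← ht, hw, h2p, Real.mul_rpow (Real.sqrt_nonneg _) (by positivity),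
      Real.rpow_mul (Real.sqrt_nonneg _), Real.rpow_two, Real.sq_sqrt hρ, ← Real.rpow_mul hr.le,
      ← Real.rpow_neg_eq_inv_rpow, Real.mul_rpow hr.le hc.le]
    -- Criticality of the exponent: `p(1 + 2a) = 1` makes the powers of `r` from the weight and from
    -- `|ψ|^{2p}` combine to `1/r`.
    have : r⁻¹ = r ^ (-p) * r ^ (-a * (2 * p)) := by
      rw [← Real.rpow_add hr, ← Real.rpow_neg_one]
      congr 1
      linear_combination hap
    rw [div_eq_mul_inv, this, hK]
    ring
  have hlog : HasDerivAt (fun s => -Real.log s) (-r⁻¹) r := (Real.hasDerivAt_log hr.ne').neg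
  have hE : HasDerivAt (fun s => Real.exp (a * -Real.log s)) (e * (a * -r⁻¹)) r :=
    (hlog.const_mul a).exp
  have h₁ := (((h.deriv_u t trivial).scomp r hlog).fun_neg).fun_mul hE
  have h₂ := ((h.deriv_v t trivial).scomp r hlog).fun_mul hE
  have hD := dirac_ansatz S γ₀ hx h₁ h₂
  have hn : ((m - 1 : ℕ) : ℝ) - 1 = 2 * a := by
    rw [Nat.cast_sub (by omega), ha]; push_cast; ring
  rw [hF, hψ]
  refine hD.trans ?_
  rw [hn]
  simp only [ansatz, smul_add, smul_smul, smul_eq_mul, Function.comp_apply, ← hrdef]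
  rw [← ht, ← he, ← hK, sub_eq_add_neg, ← neg_smul, add_comm]
  congr 2
  · field_simp
    ring
  · field_simp
    ring

end spinorOf

/-! ### The shooting problem -/

section shooting

variable {m : ℕ} {μ : ℝ} {u v : ℝ → ℝ}

theorem half_sub_pos (hm : 3 ≤ m) : 0 < ((m : ℝ) - 2) / 2 := by
  have hm' : (3 : ℝ) ≤ m := by exact_mod_cast hm
  linarith

theorem one_div_sub_one_pos (hm : 3 ≤ m) : 0 < 1 / ((m : ℝ) - 1) := by
  have hm' : (3 : ℝ) ≤ m := by exact_mod_cast hm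
  exact one_div_pos.2 (by linarith)

theorem one_div_sub_one_le (hm : 3 ≤ m) : 1 / ((m : ℝ) - 1) ≤ 1 / 2 := by
  have hm' : (3 : ℝ) ≤ m := by exact_mod_cast hm
  exact one_div_le_one_div_of_le (by norm_num) (by linarith)

theorem SpinYamabe.IsShot.isFlowOn (h : IsShot m μ u v) :
    IsFlowOn (((m : ℝ) - 2) / 2) (1 / ((m : ℝ) - 1)) u v Set.univ :=
  ⟨fun t _ => h.deriv_u t, fun t _ => h.deriv_v t⟩

theorem SpinYamabe.IsShot.sq_pos (h : IsShot m μ u v) (hμ : 0 < μ) : 0 < u 0 ^ 2 + v 0 ^ 2 := by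
  rw [h.u_zero, h.v_zero]
  positivity

theorem SpinYamabe.IsShot.zero_eq (h : IsShot m μ u v) : u 0 = v 0 := h.u_zero.trans h.v_zero.symm

theorem exists_isShot (hm : 3 ≤ m) (hμ : 0 < μ) : ∃ u v, IsShot m μ u v := by
  obtain ⟨u, v, hu, hv, h⟩ := exists_isFlowOn_univ (half_sub_pos hm).le (one_div_sub_one_pos hm)
    (one_div_sub_one_le hm) hμ
  exact ⟨u, v, hu, hv, fun t => h.deriv_u t trivial, fun t => h.deriv_v t trivial⟩

theorem SpinYamabe.IsShot.unique (hm : 3 ≤ m) {x y : ℝ → ℝ} (h : IsShot m μ u v)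
    (h' : IsShot m μ x y) : u = x ∧ v = y :=
  IsFlowOn.eq_of_zero_eq (half_sub_pos hm).le (one_div_sub_one_pos hm)
    (one_div_sub_one_le hm) h.isFlowOn h'.isFlowOn (h.u_zero.trans h'.u_zero.symm)
    (h.v_zero.trans h'.v_zero.symm)

theorem energy_eq_flowEnergy (hm : 3 ≤ m) :
    energy m u v = flowEnergy (((m : ℝ) - 2) / 2) (1 / ((m : ℝ) - 1)) u v := by
  have hm' : (3 : ℝ) ≤ m := by exact_mod_cast hm
  have h1 : (m : ℝ) - 1 ≠ 0 := by linarith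
  have e1 : (m : ℝ) / ((m : ℝ) - 1) = 1 / ((m : ℝ) - 1) + 1 := by field_simp; ring
  have e2 : ((m : ℝ) - 1) / (2 * m) = 1 / (2 * (1 / ((m : ℝ) - 1) + 1)) := by
    rw [← e1]; field_simp
  funext t
  rw [energy, flowEnergy, e1, e2]

/-- A positive parameter belongs to some `A m k` as soon as its energy is negative somewhere. -/
theorem mem_iUnion_A_iff (hm : 3 ≤ m) (h : IsShot m μ u v) (hμ : 0 < μ) :
    μ ∈ ⋃ k, A m k ↔ ∃ t, 0 ≤ t ∧ energy m u v t < 0 := by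
  have ha := half_sub_pos hm
  have hp := one_div_sub_one_pos hm
  have hp2 := one_div_sub_one_le hm
  have hf := h.isFlowOn
  rw [Set.mem_iUnion]
  constructor
  · rintro ⟨k, -, x, y, hxy, -, L, hL, hlim⟩
    obtain ⟨rfl, rfl⟩ := h.unique hm hxy
    -- The limit only provides some `t` of unknown sign; evenness of the energy moves it to `|t|`.
    obtain ⟨t, ht⟩ := (hlim.eventually_lt_const hL).exists
    refine ⟨|t|, abs_nonneg t, ?_⟩
    rw [energy_eq_flowEnergy hm] at ht ⊢
    rw [hf.flowEnergy_abs ha.le hp hp2 h.zero_eq]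
    exact_mod_cast ht
  · rintro ⟨T, hT0, hT⟩
    rw [energy_eq_flowEnergy hm] at hT
    obtain ⟨k, hk⟩ := exists_changesSign hf.continuous_right Set.ordConnected_Ioi Set.nonempty_Ioi
      (hf.finite_zeros ha hp (h.sq_pos hμ) hT0 hT)
    refine ⟨k, hμ, u, v, h, hk, ?_⟩
    rw [energy_eq_flowEnergy hm]
    exact hf.flowEnergy_tendsto ha.le hp hp2 (h.sq_pos hμ) h.zero_eq hT

theorem pos_of_mem_iUnion_A (h : μ ∈ ⋃ k, A m k) : 0 < μ := by
  obtain ⟨k, hk⟩ := Set.mem_iUnion.1 h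
  exact hk.1

theorem nonempty_iUnion_A (hm : 3 ≤ m) : (⋃ k, A m k).Nonempty := by
  have ha := half_sub_pos hm
  have hp := one_div_sub_one_pos hm
  set a := ((m : ℝ) - 2) / 2 with had
  set p := 1 / ((m : ℝ) - 1) with hpd
  -- This is the value of `ρ(0)`, with `ρ(0)^p = a/2`, small enough that the quadratic term `-aε/2`
  -- wins in the energy at time `0`.
  set ε := (a / 2) ^ (1 / p) with hε
  have hεpos : 0 < ε := by positivity
  have hεp : ε ^ p = a / 2 := by
    rw [hε, ← Real.rpow_mul (by positivity), one_div_mul_cancel hp.ne', Real.rpow_one]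
  have hμ : 0 < √(ε / 2) := by positivity
  obtain ⟨u, v, h⟩ := exists_isShot hm hμ
  refine ⟨_, (mem_iUnion_A_iff hm h hμ).2 ⟨0, le_rfl, ?_⟩⟩
  have e : √(ε / 2) ^ 2 = ε / 2 := Real.sq_sqrt (by positivity)
  rw [energy_eq_flowEnergy hm, flowEnergy, h.u_zero, h.v_zero, ← pow_two, e, add_halves,
    Real.cosh_zero, Real.one_rpow, ← had, ← hpd, Real.rpow_add_one hεpos.ne', hεp, mul_one]
  have h1 : 1 / (2 * (p + 1)) < 1 := by
    rw [div_lt_one (by positivity)]; linarith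
  have h2 : 1 / (2 * (p + 1)) * (a / 2 * ε) < 1 * (a / 2 * ε) := by gcongr
  linarith

theorem isOpen_iUnion_A (hm : 3 ≤ m) : IsOpen (⋃ k, A m k) := by
  have ha := half_sub_pos hm
  have hp := one_div_sub_one_pos hm
  rw [isOpen_iff_mem_nhds]
  intro μ₀ hμ₀
  have hpos := pos_of_mem_iUnion_A hμ₀
  choose! U V hUV using fun (μ : ℝ) (hμ : 0 < μ) => exists_isShot hm hμ
  obtain ⟨t, ht0, ht⟩ := (mem_iUnion_A_iff hm (hUV _ hpos) hpos).1 hμ₀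
  have hevpos : ∀ᶠ μ in 𝓝 μ₀, 0 < μ := eventually_gt_nhds hpos
  -- The base solution at `μ₀` plays the role of the bounded one, so `C` does not depend on `μ`.
  obtain ⟨C, hC⟩ : ∃ C, ∀ᶠ μ in 𝓝 μ₀,
      (U μ t - U μ₀ t) ^ 2 + (V μ t - V μ₀ t) ^ 2 ≤ (μ - μ₀) ^ 2 * C := by
    refine ⟨2 * Real.exp ((2 * (((m : ℝ) - 2) / 2) + 2 * ((U μ₀ 0 ^ 2 + V μ₀ 0 ^ 2)
      * Real.exp (2 * (((m : ℝ) - 2) / 2) * (t + 1))) ^ (1 / ((m : ℝ) - 1))) * t), hevpos.mono fun μ hμ => ?_⟩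
    have := IsFlowOn.dist_sq_le (T := t + 1) ha.le hp (one_div_sub_one_le hm)
      ((hUV μ hμ).isFlowOn.mono (Set.subset_univ _))
      ((hUV _ hpos).isFlowOn.mono (Set.subset_univ _)) le_rfl t ⟨ht0, lt_add_one t⟩
    rw [(hUV μ hμ).u_zero, (hUV μ hμ).v_zero] at this
    refine this.trans_eq ?_
    rw [(hUV _ hpos).u_zero, (hUV _ hpos).v_zero, ← two_mul, mul_comm 2 ((μ - μ₀) ^ 2), mul_assoc]
  have hlim : Tendsto (fun μ => (μ - μ₀) ^ 2 * C) (𝓝 μ₀) (𝓝 0) := by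
    have : Continuous fun μ => (μ - μ₀) ^ 2 * C := by fun_prop
    simpa using this.tendsto μ₀
  have key : ∀ {W : ℝ → ℝ}, (∀ᶠ μ in 𝓝 μ₀, (W μ - W μ₀) ^ 2 ≤ (μ - μ₀) ^ 2 * C) →
      Tendsto W (𝓝 μ₀) (𝓝 (W μ₀)) := by
    intro W hW
    have h0 := (squeeze_zero' (Eventually.of_forall fun μ => sq_nonneg (W μ - W μ₀)) hW hlim).sqrt
    simp only [Real.sqrt_sq_eq_abs, Real.sqrt_zero] at h0
    exact tendsto_iff_dist_tendsto_zero.2 h0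
  have hU := key (W := fun μ => U μ t) (hC.mono fun μ h => by nlinarith [sq_nonneg (V μ t - V μ₀ t)])
  have hV := key (W := fun μ => V μ t) (hC.mono fun μ h => by nlinarith [sq_nonneg (U μ t - U μ₀ t)])
  have hE : Tendsto (fun μ => energy m (U μ) (V μ) t) (𝓝 μ₀) (𝓝 (energy m (U μ₀) (V μ₀) t)) := by
    rw [energy_eq_flowEnergy hm]
    simp only [energy_eq_flowEnergy hm, flowEnergy]
    exact ((hU.mul hV).const_mul _).add ((((hU.pow 2).add (hV.pow 2)).rpow_const
      (Or.inr (by linarith))).const_mul _)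
  filter_upwards [hevpos, hE.eventually_lt_const ht] with μ hμ hlt
  exact (mem_iUnion_A_iff hm (hUV μ hμ) hμ).2 ⟨t, ht0, hlt⟩

end shooting

/-! ### Growth of the spinor -/

theorem cosh_le_exp {t : ℝ} (ht : 0 ≤ t) : Real.cosh t ≤ Real.exp t := by
  rw [Real.cosh_eq]
  have : Real.exp (-t) ≤ Real.exp t := Real.exp_le_exp.2 (by linarith)
  linarith

section growth

variable {m : ℕ} {μ : ℝ} {u v : ℝ → ℝ}

theorem SpinYamabe.IsShot.eventually_sq (hm : 3 ≤ m) (h : IsShot m μ u v)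
    (hmem : μ ∈ ⋃ k, A m k) :
    ∃ C : ℝ, ∀ᶠ t in atTop, 1 < u t ^ 2 + v t ^ 2 ∧ u t ^ 2 + v t ^ 2 ≤ C ^ 2 * Real.exp t := by
  have ha := half_sub_pos hm
  have hp := one_div_sub_one_pos hm
  have hμ := pos_of_mem_iUnion_A hmem
  obtain ⟨T, hT0, hT⟩ := (mem_iUnion_A_iff hm h hμ).1 hmem
  rw [energy_eq_flowEnergy hm] at hT
  have hf := h.isFlowOn
  set a := ((m : ℝ) - 2) / 2
  set p := 1 / ((m : ℝ) - 1)
  refine ⟨√((a * (p + 1)) ^ (1 / p)), ?_⟩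
  rw [Real.sq_sqrt (by positivity)]
  filter_upwards [(hf.tendsto_sq_atTop ha hp (h.sq_pos hμ) hT0 hT).eventually_gt_atTop 1,
    eventually_ge_atTop T] with t h1 ht
  refine ⟨h1, (sq_le_of_flowEnergy_neg ha hp
    (hf.flowEnergy_neg_of_le ha.le hp (h.sq_pos hμ) hT0 hT ht)).trans ?_⟩
  have := cosh_le_exp (hT0.trans ht)
  gcongr

theorem SpinYamabe.IsShot.sq_neg (hm : 3 ≤ m) (h : IsShot m μ u v) (t : ℝ) :
    u (-t) ^ 2 + v (-t) ^ 2 = u t ^ 2 + v t ^ 2 := by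
  obtain ⟨h1, h2⟩ := h.isFlowOn.apply_neg (half_sub_pos hm).le (one_div_sub_one_pos hm)
    (one_div_sub_one_le hm) h.zero_eq t
  rw [h1, h2, add_comm]

theorem tendsto_neg_log_norm_nhdsNE (n : ℕ) :
    Tendsto (fun x : EuclideanSpace ℝ (Fin n) => -Real.log ‖x‖) (𝓝[≠] 0) atTop :=
  tendsto_neg_atBot_atTop.comp (Real.tendsto_log_nhdsGT_zero.comp tendsto_norm_nhdsNE_zero)

theorem tendsto_log_norm_cocompact (n : ℕ) :
    Tendsto (fun x : EuclideanSpace ℝ (Fin n) => Real.log ‖x‖) (cocompact _) atTop :=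
  Real.tendsto_log_atTop.comp tendsto_norm_cocompact_atTop

variable (S : SpinRep (m - 1)) {γ₀ : Spinor (m - 1)} {x : EuclideanSpace ℝ (Fin (m - 1))}

theorem lt_norm_spinorOf (hγ₀ : ‖γ₀‖ = 1) (hx : x ≠ 0)
    (h : 1 < u (-Real.log ‖x‖) ^ 2 + v (-Real.log ‖x‖) ^ 2) :
    ‖x‖ ^ (-(((m : ℝ) - 2) / 2)) < ‖spinorOf m S γ₀ u v x‖ := by
  rw [norm_spinorOf S hγ₀ hx]
  exact lt_mul_of_one_lt_left (Real.rpow_pos_of_pos (norm_pos_iff.2 hx) _)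
    (Real.lt_sqrt_of_sq_lt (by simpa using h))

theorem norm_spinorOf_le (hγ₀ : ‖γ₀‖ = 1) (hx : x ≠ 0) {C b : ℝ}
    (h : u (-Real.log ‖x‖) ^ 2 + v (-Real.log ‖x‖) ^ 2 ≤ C ^ 2 * ‖x‖ ^ b) :
    ‖spinorOf m S γ₀ u v x‖ ≤ |C| * ‖x‖ ^ (b / 2 - ((m : ℝ) - 2) / 2) := by
  have hr : 0 < ‖x‖ := norm_pos_iff.2 hx
  rw [norm_spinorOf S hγ₀ hx, sub_eq_add_neg (b / 2), Real.rpow_add hr, ← mul_assoc]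
  refine mul_le_mul_of_nonneg_right (Real.sqrt_le_iff.2 ⟨by positivity, h.trans_eq ?_⟩)
    (Real.rpow_pos_of_pos hr _).le
  rw [mul_pow, sq_abs, ← Real.rpow_natCast (‖x‖ ^ (b / 2)), ← Real.rpow_mul hr.le]
  congr 2
  push_cast
  ring

end growth

/-! ### The one-parameter family -/

theorem corollary1p5 (m : ℕ) (hm : 3 ≤ m) (S : SpinRep (m - 1)) (γ₀ : Spinor (m - 1))
    (hγ₀ : ‖γ₀‖ = 1) :
    -- the shooting problem is well posed, so that `A m k` speaks of the solution `(u_μ, v_μ)`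
    (∀ μ : ℝ, 0 < μ → ∃! w : (ℝ → ℝ) × (ℝ → ℝ), IsShot m μ w.1 w.2) ∧
    -- the parameter set is a genuine one-dimensional one
    (⋃ k, A m k).Nonempty ∧ IsOpen (⋃ k, A m k) ∧
    -- the one-parameter family
    ∃ ψ : ℝ → EuclideanSpace ℝ (Fin (m - 1)) → Spinor (m - 1),
      (∀ μ ∈ ⋃ k, A m k, ∀ μ' ∈ ⋃ k, A m k, Set.EqOn (ψ μ) (ψ μ') {0}ᶜ → μ = μ') ∧
      ∀ μ ∈ ⋃ k, A m k,
        (∃ u v : ℝ → ℝ, IsShot m μ u v ∧ Set.EqOn (ψ μ) (spinorOf m S γ₀ u v) {0}ᶜ) ∧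
        IsSolution m S (ψ μ) ∧ IsSingular (ψ μ) ∧
        (∀ᶠ x in 𝓝[≠] 0, ‖x‖ ^ (-(((m : ℝ) - 2) / 2)) < ‖ψ μ x‖) ∧
        (ψ μ =O[𝓝[≠] 0] fun x => ‖x‖ ^ (-(((m : ℝ) - 1) / 2))) ∧
        (∀ᶠ x in cocompact (EuclideanSpace ℝ (Fin (m - 1))),
          ‖x‖ ^ (-(((m : ℝ) - 2) / 2)) < ‖ψ μ x‖) ∧
        (ψ μ =O[cocompact (EuclideanSpace ℝ (Fin (m - 1)))]
          fun x => ‖x‖ ^ (-(((m : ℝ) - 3) / 2))) := by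
  have ha := half_sub_pos hm
  choose! U V hUV using fun (μ : ℝ) (hμ : 0 < μ) => exists_isShot hm hμ
  refine ⟨fun μ hμ => ⟨(U μ, V μ), hUV μ hμ, fun w hw => ?_⟩, nonempty_iUnion_A hm,
    isOpen_iUnion_A hm, fun μ => spinorOf m S γ₀ (U μ) (V μ), fun μ hμ μ' hμ' heq => ?_,
    fun μ hmem => ?_⟩
  · obtain ⟨h1, h2⟩ := hw.unique hm (hUV μ hμ)
    exact Prod.ext h1 h2
  · have hμ := pos_of_mem_iUnion_A hμ
    have hμ' := pos_of_mem_iUnion_A hμ'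
    -- On the unit sphere `t = 0`, where `|ψ_μ|² = 2μ²`; this recovers `μ`.
    let x : EuclideanSpace ℝ (Fin (m - 1)) := EuclideanSpace.single ⟨0, by omega⟩ 1
    have hx1 : ‖x‖ = 1 := by simp [x]
    have hx : x ≠ 0 := norm_ne_zero_iff.1 (by rw [hx1]; exact one_ne_zero)
    have h := congrArg norm (heq (x := x) hx)
    simp only [norm_spinorOf S hγ₀ hx, hx1, Real.log_one, neg_zero, Real.one_rpow, mul_one,
      (hUV μ hμ).u_zero, (hUV μ hμ).v_zero, (hUV μ' hμ').u_zero, (hUV μ' hμ').v_zero] at h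
    rw [Real.sqrt_inj (by positivity) (by positivity)] at h
    exact (sq_eq_sq₀ hμ.le hμ'.le).1 (by linarith)
  · have hμ := pos_of_mem_iUnion_A hmem
    have h := hUV μ hμ
    obtain ⟨hu, hv⟩ := h.isFlowOn.contDiff ha.le (h.sq_pos hμ)
    obtain ⟨C, hC⟩ := h.eventually_sq hm hmem
    have hne : ∀ᶠ x : EuclideanSpace ℝ (Fin (m - 1)) in 𝓝[≠] 0, x ≠ 0 := eventually_mem_nhdsWithin
    have hne' : ∀ᶠ x in cocompact (EuclideanSpace ℝ (Fin (m - 1))), x ≠ 0 :=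
      (tendsto_norm_cocompact_atTop.eventually_gt_atTop 0).mono fun x => norm_pos_iff.1
    have hC0 := (tendsto_neg_log_norm_nhdsNE (m - 1)).eventually hC
    have hCi := (tendsto_log_norm_cocompact (m - 1)).eventually hC
    have hlow : ∀ᶠ x in 𝓝[≠] 0,
        ‖x‖ ^ (-(((m : ℝ) - 2) / 2)) < ‖spinorOf m S γ₀ (U μ) (V μ) x‖ := by
      filter_upwards [hne, hC0] with x hx hx'
      exact lt_norm_spinorOf S hγ₀ hx hx'.1
    refine ⟨⟨U μ, V μ, h, Set.eqOn_refl _ _⟩, ⟨spinorOf_contDiffOn S hu hv, fun x hx =>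
      dirac_spinorOf S hm hγ₀ h.isFlowOn hx⟩, ?_, hlow, ?_, ?_, ?_⟩
    · refine tendsto_atTop_mono' _ (hlow.mono fun x => le_of_lt) ?_
      exact (tendsto_rpow_neg_nhdsGT_zero (neg_lt_zero.2 ha)).comp tendsto_norm_nhdsNE_zero
    · refine IsBigO.of_bound |C| ?_
      filter_upwards [hne, hC0] with x hx hx'
      have hr : 0 < ‖x‖ := norm_pos_iff.2 hx
      -- Near the origin `e^t = |x|⁻¹`, hence `b = -1`.
      refine (norm_spinorOf_le S hγ₀ hx (C := C) (b := -1) ?_).trans_eq ?_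
      · rw [Real.rpow_neg_one, ← Real.exp_log hr, ← Real.exp_neg, Real.exp_log hr]
        exact hx'.2
      · rw [Real.norm_of_nonneg (by positivity)]
        congr 2
        ring
    · filter_upwards [hne', hCi] with x hx hx'
      exact lt_norm_spinorOf S hγ₀ hx (by rw [h.sq_neg hm]; exact hx'.1)
    · refine IsBigO.of_bound |C| ?_
      filter_upwards [hne', hCi] with x hx hx'
      have hr : 0 < ‖x‖ := norm_pos_iff.2 hx
      -- At infinity `t → -∞`; evenness of `ρ` allows the bound at time `log |x|`, whose exponential
      -- is `|x|`, hence `b = 1`.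
      refine (norm_spinorOf_le S hγ₀ hx (C := C) (b := 1) ?_).trans_eq ?_
      · rw [h.sq_neg hm, Real.rpow_one]
        simpa only [Real.exp_log hr] using hx'.2
      · rw [Real.norm_of_nonneg (by positivity)]
        congr 2
        ring
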